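/- Let $D\subset\mathbb R^2$ be open with coordinates $(x,y)$, and let $S$ be a surface in $\mathbb P^3$ (real projective space) parametrized by $D$, with a smooth lift $f:D\to\mathbb R^4\setminus\{0\}$ satisfying the canonical system $$f_{xx}=b f_y+p f,\qquad f_{yy}=c f_x+q f$$ with smooth functions $b,c,p,q$ on $D$ and $bc\neq 0$ everywhere (so $(x,y)$ are asymptotic coordinates, regarded as null coordinates of the Lorentz conformal structure $[dx\,dy]$ on $D$). Let $F=(f,f_1,f_2,\eta)$ be the Wilczynski frame, $$f_1=f_x-\tfrac{c_x}{2c}f,\quad f_2=f_y-\tfrac{b_y}{2b}f,\quad \eta=f_{xy}-\tfrac{c_x}{2c}f_y-\tfrac{b_y}{2b}f_x+\Big(\tfrac{b_yc_x}{4bc}-\tfrac{bc}{2}\Big)f,$$ and assume that $F$ takes values in $\mathrm{SL}_4\mathbb R$. Put $$P=p+\tfrac{b_y}{2}-\tfrac{c_{xx}}{2c}+\tfrac{c_x^2}{4c^2},\qquad Q=q+\tfrac{c_x}{2}-\tfrac{b_{yy}}{2b}+\tfrac{b_y^2}{4b^2}.$$ Let $g_2=FJ_2F^t$, with $J_2=\operatorname{offdiag}(1,-1,-1,1)$,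 be the Lie quadric of $S$; its points are the $[\zeta]$ with $\zeta^tg_2^{-1}\zeta=0$. The Demoulin transforms of $S$ at a point of $D$ are the points $[\zeta]\neq[f]$ of complex projective space $\mathbb P^3(\mathbb C)$ in which the Lie quadric meets the envelope of the family of Lie quadrics, i.e. $\zeta^t\Phi\zeta=\zeta^t\Phi_x\zeta=\zeta^t\Phi_y\zeta=0$ with $\Phi=g_2^{-1}$ (in general there are four). $S$ is a \emph{Demoulin surface} if at every point of $D$ its Demoulin transforms coincide, i.e. there is exactly one such point $[\zeta]$. Let $\mathcal Q$ be the symmetric space $\mathrm{SL}_4\mathbb R/\mathrm{SO}_{2,2}$ of real symmetric $4\times4$ matrices of determinant one and signature $(2,2)$, with the invariant metric $\langle X,Y\rangle_m=\operatorname{Tr}(m^{-1}Xm^{-1}Y)$, and let $g_1=FJ_1F^t$, with $J_1=\operatorname{offdiag}(1,1,1,1)$, be the first-order Gauss map of $S$. Call a map $g:D\to\mathcal Q$ \emph{conformal} if $g^*\langle\cdot,\cdot\rangle$ is a multiple of $dx\,dy$ by a function (which may have zeros), and \emph{Lorentz harmonic} if it is smooth and its tension field, the trace of $\nabla dg$ with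 respect to the Lorentz metric $2\,dx\,dy$ and the Levi-Civita connection $\nabla$ of $\mathcal Q$, vanishes. Then the following are equivalent: (1) $S$ is a Demoulin surface; (2) $g_1$ is a conformal Lorentz harmonic map into $\mathcal Q$. Moreover, (1) is equivalent to $P=Q=0$ on $D$. -/

import Mathlib

open Matrix Set
open scoped ContDiff LinearAlgebra.Projectivization

noncomputable section

/-- Partial derivative with respect to the first coordinate `x` of the plane. -/
def dX {E : Type*} [NormedAddCommGroup E] [NormedSpace ℝ E] (u : ℝ × ℝ → E) (z : ℝ × ℝ) : E :=
  fderiv ℝ u z (1, 0)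

/-- Partial derivative with respect to the second coordinate `y` of the plane. -/
def dY {E : Type*} [NormedAddCommGroup E] [NormedSpace ℝ E] (u : ℝ × ℝ → E) (z : ℝ × ℝ) : E :=
  fderiv ℝ u z (0, 1)

/-- The vector `f₁ = f_x - (c_x / 2c) f`. -/
def frameOne (f : ℝ × ℝ → Fin 4 → ℝ) (c : ℝ × ℝ → ℝ) (z : ℝ × ℝ) : Fin 4 → ℝ :=
  dX f z - (dX c z / (2 * c z)) • f z

/-- The vector `f₂ = f_y - (b_y / 2b) f`. -/
def frameTwo (f : ℝ × ℝ → Fin 4 → ℝ) (b : ℝ × ℝ → ℝ) (z : ℝ × ℝ) : Fin 4 → ℝ :=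
  dY f z - (dY b z / (2 * b z)) • f z

/-- The vector `η = f_xy - (c_x / 2c) f_y - (b_y / 2b) f_x + (b_y c_x / 4bc - bc / 2) f`. -/
def frameEta (f : ℝ × ℝ → Fin 4 → ℝ) (b c : ℝ × ℝ → ℝ) (z : ℝ × ℝ) : Fin 4 → ℝ :=
  dY (dX f) z - (dX c z / (2 * c z)) • dY f z - (dY b z / (2 * b z)) • dX f z
    + (dY b z * dX c z / (4 * b z * c z) - b z * c z / 2) • f z

/-- The Wilczynski frame: the matrix with columns `f, f₁, f₂, η`. -/
def wilczynskiFrame (f : ℝ × ℝ → Fin 4 → ℝ) (b c : ℝ × ℝ → ℝ) (z : ℝ × ℝ) :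
    Matrix (Fin 4) (Fin 4) ℝ :=
  (Matrix.of ![f z, frameOne f c z, frameTwo f b z, frameEta f b c z])ᵀ

/-- `f` is a lift to `ℝ⁴` of a smooth surface in `ℙ³`, in asymptotic coordinates `(x, y)` ranging
over `D`, which solves the canonical system `f_xx = b f_y + p f`, `f_yy = c f_x + q f`, has
nowhere vanishing Fubini-Pick invariant `8bc`, and whose Wilczynski frame takes values in the
special linear group. -/
structure IsCanonicalSurface (D : Set (ℝ × ℝ)) (f : ℝ × ℝ → Fin 4 → ℝ)
    (b c p q : ℝ × ℝ → ℝ) : Prop where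
  smooth_f : ContDiffOn ℝ ∞ f D
  smooth_b : ContDiffOn ℝ ∞ b D
  smooth_c : ContDiffOn ℝ ∞ c D
  smooth_p : ContDiffOn ℝ ∞ p D
  smooth_q : ContDiffOn ℝ ∞ q D
  eq_xx : ∀ z ∈ D, dX (dX f) z = b z • dY f z + p z • f z
  eq_yy : ∀ z ∈ D, dY (dY f) z = c z • dX f z + q z • f z
  bc_ne : ∀ z ∈ D, b z * c z ≠ 0
  det_frame : ∀ z ∈ D, (wilczynskiFrame f b c z).det = 1

/-- The function `P = p + b_y / 2 - c_xx / 2c + c_x² / 4c²`. -/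
def invP (b c p : ℝ × ℝ → ℝ) (z : ℝ × ℝ) : ℝ :=
  p z + dY b z / 2 - dX (dX c) z / (2 * c z) + dX c z ^ 2 / (4 * c z ^ 2)

/-- The function `Q = q + c_x / 2 - b_yy / 2b + b_y² / 4b²`. -/
def invQ (b c q : ℝ × ℝ → ℝ) (z : ℝ × ℝ) : ℝ :=
  q z + dX c z / 2 - dY (dY b) z / (2 * b z) + dY b z ^ 2 / (4 * b z ^ 2)

/-- `J₁ = offdiag (1, 1, 1, 1)`. -/
def matJ1 : Matrix (Fin 4) (Fin 4) ℝ :=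
  !![0, 0, 0, 1; 0, 0, 1, 0; 0, 1, 0, 0; 1, 0, 0, 0]

/-- `J₂ = offdiag (1, -1, -1, 1)`. -/
def matJ2 : Matrix (Fin 4) (Fin 4) ℝ :=
  !![0, 0, 0, 1; 0, 0, -1, 0; 0, -1, 0, 0; 1, 0, 0, 0]

/-- The first-order Gauss map `g₁ = F J₁ Fᵗ`. -/
def firstOrderGaussMap (f : ℝ × ℝ → Fin 4 → ℝ) (b c : ℝ × ℝ → ℝ) (z : ℝ × ℝ) :
    Matrix (Fin 4) (Fin 4) ℝ :=
  wilczynskiFrame f b c z * matJ1 * (wilczynskiFrame f b c z)ᵀ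

/-- The Lie quadric of the surface, as the symmetric matrix `g₂ = F J₂ Fᵗ` (a quadratic form on
the dual space). Its points are the `[ζ]` with `ζᵗ g₂⁻¹ ζ = 0`; in coordinates with respect to the
frame `F` this is the quadric `w₀ w₃ = w₁ w₂`. -/
def lieQuadric (f : ℝ × ℝ → Fin 4 → ℝ) (b c : ℝ × ℝ → ℝ) (z : ℝ × ℝ) :
    Matrix (Fin 4) (Fin 4) ℝ :=
  wilczynskiFrame f b c z * matJ2 * (wilczynskiFrame f b c z)ᵀ

/-- The derivative at `z` in the direction `v` of a matrix-valued map, entry by entry. -/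
def matDeriv (φ : ℝ × ℝ → Matrix (Fin 4) (Fin 4) ℝ) (z v : ℝ × ℝ) : Matrix (Fin 4) (Fin 4) ℝ :=
  Matrix.of fun i j => fderiv ℝ (fun w => φ w i j) z v

/-- The complex quadratic form with real matrix `A`, evaluated at `ζ`. -/
def cQuad (A : Matrix (Fin 4) (Fin 4) ℝ) (ζ : Fin 4 → ℂ) : ℂ :=
  ζ ⬝ᵥ (A.map Complex.ofReal) *ᵥ ζ

/-- The set of points of complex projective 3-space in which the two-parameter family of Lie
quadrics `Φ = g₂⁻¹` meets its envelope at parameter `z` (that is, `Φ = Φ_x = Φ_y = 0`), other than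
the point `[f z]` of the surface itself. For a general surface there are four such points, the
values at `z` of the four Demoulin transforms; complex points have to be admitted, because the
transforms may be imaginary. -/
def demoulinTransforms (f : ℝ × ℝ → Fin 4 → ℝ) (b c : ℝ × ℝ → ℝ) (z : ℝ × ℝ) :
    Set (ℙ ℂ (Fin 4 → ℂ)) :=
  {P | cQuad (lieQuadric f b c z)⁻¹ P.rep = 0 ∧
    cQuad (matDeriv (fun w => (lieQuadric f b c w)⁻¹) z (1, 0)) P.rep = 0 ∧
    cQuad (matDeriv (fun w => (lieQuadric f b c w)⁻¹) z (0, 1)) P.rep = 0 ∧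
    (fun i => (f z i : ℂ)) ∉ P.submodule}

/-- A Demoulin surface: its Demoulin transforms coincide everywhere. -/
def IsDemoulinSurface (D : Set (ℝ × ℝ)) (f : ℝ × ℝ → Fin 4 → ℝ) (b c : ℝ × ℝ → ℝ) : Prop :=
  ∀ z ∈ D, ∃! P, P ∈ demoulinTransforms f b c z

/-- The symmetric space of real symmetric `4 × 4` matrices of determinant one and
signature `(2, 2)`. -/
def quadricSpace : Set (Matrix (Fin 4) (Fin 4) ℝ) :=
  {m | m.IsSymm ∧ m.det = 1 ∧
    sigPos m.toQuadraticForm' = 2 ∧ sigNeg m.toQuadraticForm' = 2}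

/-- The invariant pseudo-Riemannian metric `⟨X, Y⟩ = Tr (m⁻¹ X m⁻¹ Y)` of the space of quadrics. -/
def quadricMetric (m X Y : Matrix (Fin 4) (Fin 4) ℝ) : ℝ :=
  (m⁻¹ * X * m⁻¹ * Y).trace

/-- The Levi-Civita covariant derivative, in the direction `v` at `z`, of a vector field `Y` along
a map `φ` into the space of quadrics: `∇_v Y = D_v Y - (D_v φ · φ⁻¹ · Y + Y · φ⁻¹ · D_v φ) / 2`. It
is symmetric in the two arguments that enter the Christoffel term, and metric by
`fderiv_quadricMetric`; the determinant-one matrices are totally geodesic for it. -/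
def covDeriv (φ Y : ℝ × ℝ → Matrix (Fin 4) (Fin 4) ℝ) (z v : ℝ × ℝ) :
    Matrix (Fin 4) (Fin 4) ℝ :=
  matDeriv Y z v -
    (1 / 2 : ℝ) • (matDeriv φ z v * (φ z)⁻¹ * Y z + Y z * (φ z)⁻¹ * matDeriv φ z v)

/-- Product rule for `matDeriv`. -/
theorem matDeriv_mul {A B : ℝ × ℝ → Matrix (Fin 4) (Fin 4) ℝ} {z : ℝ × ℝ} (v : ℝ × ℝ)
    (hA : ∀ i j, DifferentiableAt ℝ (fun w => A w i j) z)
    (hB : ∀ i j, DifferentiableAt ℝ (fun w => B w i j) z) :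
    matDeriv (fun w => A w * B w) z v = matDeriv A z v * B z + A z * matDeriv B z v := by
  ext i j
  simp only [matDeriv, Matrix.mul_apply, Matrix.of_apply, Matrix.add_apply]
  rw [fderiv_fun_sum fun k _ => (hA i k).fun_mul (hB k j), _root_.sum_apply,
    ← Finset.sum_add_distrib]
  refine Finset.sum_congr rfl fun k _ => ?_
  rw [fderiv_fun_mul (hA i k) (hB k j)]
  simp only [_root_.add_apply, _root_.smul_apply, smul_eq_mul]
  ring

/-- The entries of a product of differentiable matrix-valued maps are differentiable. -/
theorem differentiableAt_matMul {A B : ℝ × ℝ → Matrix (Fin 4) (Fin 4) ℝ} {z : ℝ × ℝ}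
    (hA : ∀ i j, DifferentiableAt ℝ (fun w => A w i j) z)
    (hB : ∀ i j, DifferentiableAt ℝ (fun w => B w i j) z) (i j : Fin 4) :
    DifferentiableAt ℝ (fun w => (A w * B w) i j) z := by
  simp only [Matrix.mul_apply]
  exact DifferentiableAt.fun_sum fun k _ => (hA i k).mul (hB k j)

/-- The determinant of a differentiable matrix-valued map is differentiable. -/
theorem differentiableAt_matDet {A : ℝ × ℝ → Matrix (Fin 4) (Fin 4) ℝ} {z : ℝ × ℝ}
    (hA : ∀ i j, DifferentiableAt ℝ (fun w => A w i j) z) :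
    DifferentiableAt ℝ (fun w => (A w).det) z := by
  simp only [Matrix.det_apply']
  refine DifferentiableAt.fun_sum fun σ _ => (differentiableAt_const _).mul ?_
  have h := (HasFDerivAt.finsetProd (u := Finset.univ) (g := fun k w => A w (σ k) k)
    fun k _ => (hA (σ k) k).hasFDerivAt).differentiableAt
  simpa [Finset.prod_fn] using h

/-- The entries of the inverse of a differentiable matrix-valued map are differentiable. -/
theorem differentiableAt_matInv {A : ℝ × ℝ → Matrix (Fin 4) (Fin 4) ℝ} {z : ℝ × ℝ}
    (hA : ∀ i j, DifferentiableAt ℝ (fun w => A w i j) z) (hdet : (A z).det ≠ 0) (i j : Fin 4) :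
    DifferentiableAt ℝ (fun w => (A w)⁻¹ i j) z := by
  simp only [Matrix.inv_def, Matrix.smul_apply, smul_eq_mul, Ring.inverse_eq_inv',
    Matrix.adjugate_apply]
  refine ((differentiableAt_matDet hA).inv hdet).mul (differentiableAt_matDet fun k l => ?_)
  simp only [Matrix.updateRow_apply]
  split_ifs
  · exact differentiableAt_const _
  · exact hA k l

/-- The derivative of the inverse of a matrix-valued map. -/
theorem matDeriv_inv {A : ℝ × ℝ → Matrix (Fin 4) (Fin 4) ℝ} {z : ℝ × ℝ} (v : ℝ × ℝ)
    (hA : ∀ i j, DifferentiableAt ℝ (fun w => A w i j) z) (hdet : (A z).det ≠ 0) :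
    matDeriv (fun w => (A w)⁻¹) z v = -((A z)⁻¹ * matDeriv A z v * (A z)⁻¹) := by
  have h1 := matDeriv_mul v (differentiableAt_matInv hA hdet) hA
  have hev : ∀ᶠ w in nhds z, (A w).det ≠ 0 :=
    (differentiableAt_matDet hA).continuousAt.eventually_ne hdet
  have h2 : matDeriv (fun w => (A w)⁻¹ * A w) z v = 0 := by
    ext i j
    have h3 : (fun w => ((A w)⁻¹ * A w) i j) =ᶠ[nhds z]
        fun _ => (1 : Matrix (Fin 4) (Fin 4) ℝ) i j := by
      filter_upwards [hev] with w hw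
      rw [Matrix.nonsing_inv_mul _ (isUnit_iff_ne_zero.mpr hw)]
    simp [matDeriv, h3.fderiv_eq]
  rw [h2] at h1
  have h4 := congrArg (· * (A z)⁻¹) h1
  simp only [Matrix.zero_mul, Matrix.add_mul, Matrix.mul_assoc,
    Matrix.mul_nonsing_inv _ (isUnit_iff_ne_zero.mpr hdet), Matrix.mul_one] at h4
  rw [Matrix.mul_assoc]
  exact eq_neg_of_add_eq_zero_left h4.symm

/-- The covariant derivative `covDeriv` is compatible with the metric `quadricMetric`. -/
theorem fderiv_quadricMetric {φ Y Z : ℝ × ℝ → Matrix (Fin 4) (Fin 4) ℝ} {z : ℝ × ℝ} (v : ℝ × ℝ)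
    (hφ : ∀ i j, DifferentiableAt ℝ (fun w => φ w i j) z)
    (hY : ∀ i j, DifferentiableAt ℝ (fun w => Y w i j) z)
    (hZ : ∀ i j, DifferentiableAt ℝ (fun w => Z w i j) z) (hdet : (φ z).det ≠ 0) :
    fderiv ℝ (fun w => quadricMetric (φ w) (Y w) (Z w)) z v =
      quadricMetric (φ z) (covDeriv φ Y z v) (Z z) +
        quadricMetric (φ z) (Y z) (covDeriv φ Z z v) := by
  have hi := differentiableAt_matInv hφ hdet
  have h1 := differentiableAt_matMul hi hY
  have h2 := differentiableAt_matMul h1 hi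
  have h3 := differentiableAt_matMul h2 hZ
  have ht : fderiv ℝ (fun w => quadricMetric (φ w) (Y w) (Z w)) z v =
      (matDeriv (fun w => (φ w)⁻¹ * Y w * (φ w)⁻¹ * Z w) z v).trace := by
    simp only [quadricMetric, Matrix.trace, Matrix.diag_apply, matDeriv, Matrix.of_apply]
    rw [fderiv_fun_sum fun k _ => h3 k k, _root_.sum_apply]
  rw [ht, matDeriv_mul v h2 hZ, matDeriv_mul v h1 hi, matDeriv_mul v hi hY, matDeriv_inv v hφ hdet]
  simp only [quadricMetric, covDeriv]
  generalize matDeriv φ z v = X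
  generalize matDeriv Y z v = Y'
  generalize matDeriv Z z v = Z'
  generalize (φ z)⁻¹ = m
  generalize Y z = Y₀
  generalize Z z = Z₀
  have hc : (m * Y₀ * m * (Z₀ * m * X)).trace = (m * X * m * Y₀ * m * Z₀).trace := by
    rw [show m * Y₀ * m * (Z₀ * m * X) = (m * Y₀ * m * Z₀) * (m * X) by
      simp only [Matrix.mul_assoc], Matrix.trace_mul_comm]
    simp only [Matrix.mul_assoc]
  simp only [Matrix.mul_assoc] at hc
  simp only [Matrix.mul_sub, Matrix.sub_mul, Matrix.mul_add, Matrix.add_mul, Matrix.mul_smul,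
    Matrix.smul_mul, Matrix.trace_add, Matrix.trace_sub, Matrix.trace_smul, Matrix.neg_mul,
    Matrix.mul_neg, Matrix.trace_neg, smul_eq_mul, Matrix.mul_assoc, hc]
  ring

/-- The tension field of `φ`: the trace of `∇dφ` with respect to the Lorentz metric `2 dx dy`, for
which `x` and `y` are null coordinates. -/
def lorentzTension (φ : ℝ × ℝ → Matrix (Fin 4) (Fin 4) ℝ) (z : ℝ × ℝ) :
    Matrix (Fin 4) (Fin 4) ℝ :=
  covDeriv φ (fun w => matDeriv φ w (0, 1)) z (1, 0) +
    covDeriv φ (fun w => matDeriv φ w (1, 0)) z (0, 1)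

/-- `φ` is a (smooth) Lorentz harmonic map from `D`, with null coordinates `(x, y)`, into the space
of quadrics. -/
def IsLorentzHarmonic (D : Set (ℝ × ℝ)) (φ : ℝ × ℝ → Matrix (Fin 4) (Fin 4) ℝ) : Prop :=
  (∀ i j, ContDiffOn ℝ ∞ (fun z => φ z i j) D) ∧ MapsTo φ D quadricSpace ∧
    ∀ z ∈ D, lorentzTension φ z = 0

/-- `φ` is conformal: the pullback of the metric of the space of quadrics is a multiple `ρ` of the
Lorentz metric `2 dx dy`. The factor `ρ` may have zeros. -/
def IsLorentzConformal (D : Set (ℝ × ℝ)) (φ : ℝ × ℝ → Matrix (Fin 4) (Fin 4) ℝ) : Prop :=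
  ∃ ρ : ℝ × ℝ → ℝ, ∀ z ∈ D, ∀ v w : ℝ × ℝ,
    quadricMetric (φ z) (matDeriv φ z v) (matDeriv φ z w) = ρ z * (v.1 * w.2 + v.2 * w.1)

end

/-! Everything is read off in the Wilczynski frame, and both conditions reduce to `P = Q = 0`.

Write `F_x = F U`, `F_y = F V`, and put `α = c_x/2c`, `β = b_y/2b`, `k = bc/2 - α_y`, `l = bc/2 -
β_x`. Differentiating the canonical system (`structure_equations`) and comparing the mixed
derivatives of `F` (`connection_integrability`) identifies `U` and `V`: their corner entries are
`bQ` and `cP`, and two compatibility equations `P_y = k_x + 2αk`, `Q_x = l_y + 2βl` remain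
(`IsCanonicalSurface.exists_connection`).

Demoulin transforms. In coordinates `w` with respect to `F`, the Lie quadric and its two derivatives
become `w₀w₃ = w₁w₂`, `w₁² = Q w₃²`, `w₂² = P w₃²`, since `U` and `V` fail to be skew for `J₂` only
in the entries `b, bQ` and `c, cP` (`IsCanonicalSurface.mem_demoulinTransforms_iff`). The solutions
with `w₃ = 0` give `[f]`; the others are `[st : s : t : 1]` with `s² = Q`, `t² = P`. There is
exactly one of them iff `P = Q = 0`.

Conformality. By invariance of the metric, the squared lengths of `∂_x g₁` and `∂_y g₁` are `16P`
and `16Q`, so conformality alone is already equivalent to `P = Q = 0`.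

Harmonicity. The covariant derivative along `F J₁ Fᵗ` acts in the frame through the `J₁`-skew parts
of `U` and `V` (`covDeriv_mul_mul_transpose`), and these are just the diagonals. When `P = Q = 0`,
the compatibility equations together with `c_x = 2αc`, `b_y = 2βb` say exactly that `∇_x ∂_y g₁` and
`∇_y ∂_x g₁` vanish. -/

/-! ### Calculus of directional derivatives on an open set of the plane. -/

noncomputable section DirectionalDerivative

variable {E : Type*} [NormedAddCommGroup E] [NormedSpace ℝ E] {D : Set (ℝ × ℝ)}

/-- The derivative of `u` in the direction `v`, as a function on the plane. -/
def dirDeriv (v : ℝ × ℝ) (u : ℝ × ℝ → E) (z : ℝ × ℝ) : E :=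
  fderiv ℝ u z v

theorem ContDiffOn.differentiableAt_of_isOpen (hD : IsOpen D) {u : ℝ × ℝ → E}
    (hu : ContDiffOn ℝ ∞ u D) {z : ℝ × ℝ} (hz : z ∈ D) : DifferentiableAt ℝ u z :=
  (hu.contDiffAt (hD.mem_nhds hz)).differentiableAt (by simp)

theorem contDiffOn_dirDeriv (hD : IsOpen D) (v : ℝ × ℝ) {u : ℝ × ℝ → E}
    (hu : ContDiffOn ℝ ∞ u D) : ContDiffOn ℝ ∞ (dirDeriv v u) D :=
  (hu.fderiv_of_isOpen hD (by simp)).clm_apply contDiffOn_const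

theorem dirDeriv_congr (hD : IsOpen D) (v : ℝ × ℝ) {u u' : ℝ × ℝ → E}
    (h : ∀ z ∈ D, u z = u' z) {z : ℝ × ℝ} (hz : z ∈ D) : dirDeriv v u z = dirDeriv v u' z := by
  have h' : u =ᶠ[nhds z] u' := Filter.eventually_of_mem (hD.mem_nhds hz) h
  rw [dirDeriv, dirDeriv, h'.fderiv_eq]

theorem dirDeriv_add (v : ℝ × ℝ) {u u' : ℝ × ℝ → E} {z : ℝ × ℝ}
    (hu : DifferentiableAt ℝ u z) (hu' : DifferentiableAt ℝ u' z) :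
    dirDeriv v (fun w => u w + u' w) z = dirDeriv v u z + dirDeriv v u' z := by
  rw [dirDeriv, fderiv_fun_add hu hu']; rfl

theorem dirDeriv_sub (v : ℝ × ℝ) {u u' : ℝ × ℝ → E} {z : ℝ × ℝ}
    (hu : DifferentiableAt ℝ u z) (hu' : DifferentiableAt ℝ u' z) :
    dirDeriv v (fun w => u w - u' w) z = dirDeriv v u z - dirDeriv v u' z := by
  rw [dirDeriv, fderiv_fun_sub hu hu']; rfl

theorem dirDeriv_smul (v : ℝ × ℝ) {a : ℝ × ℝ → ℝ} {u : ℝ × ℝ → E} {z : ℝ × ℝ}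
    (ha : DifferentiableAt ℝ a z) (hu : DifferentiableAt ℝ u z) :
    dirDeriv v (fun w => a w • u w) z = a z • dirDeriv v u z + dirDeriv v a z • u z := by
  rw [dirDeriv, fderiv_fun_smul ha hu]; rfl

theorem dirDeriv_comm (hD : IsOpen D) (v w : ℝ × ℝ) {u : ℝ × ℝ → E}
    (hu : ContDiffOn ℝ ∞ u D) {z : ℝ × ℝ} (hz : z ∈ D) :
    dirDeriv v (dirDeriv w u) z = dirDeriv w (dirDeriv v u) z := by
  have hc := hu.contDiffAt (hD.mem_nhds hz)
  have hd : DifferentiableAt ℝ (fderiv ℝ u) z :=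
    (hu.fderiv_of_isOpen (m := ∞) hD (by simp)).differentiableAt_of_isOpen hD hz
  have key : ∀ a b : ℝ × ℝ, dirDeriv a (dirDeriv b u) z = fderiv ℝ (fderiv ℝ u) z a b := by
    intro a b
    change fderiv ℝ (fun y => fderiv ℝ u y b) z a = _
    rw [fderiv_clm_apply hd (differentiableAt_const b)]
    simp
  rw [key, key]
  exact (hc.isSymmSndFDerivAt (by
    rw [minSmoothness_of_isRCLikeNormedField]; exact WithTop.coe_le_coe.2 le_top)) v w

/-- The function `c_v / 2c`, half the logarithmic derivative of `c`. -/
def halfLogDeriv (v : ℝ × ℝ) (c : ℝ × ℝ → ℝ) (z : ℝ × ℝ) : ℝ :=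
  dirDeriv v c z / (2 * c z)

theorem contDiffOn_halfLogDeriv (hD : IsOpen D) (v : ℝ × ℝ) {c : ℝ × ℝ → ℝ}
    (hc : ContDiffOn ℝ ∞ c D) (h0 : ∀ z ∈ D, c z ≠ 0) :
    ContDiffOn ℝ ∞ (halfLogDeriv v c) D :=
  (contDiffOn_dirDeriv hD v hc).div (contDiffOn_const.mul hc)
    fun z hz => mul_ne_zero two_ne_zero (h0 z hz)

theorem dirDeriv_halfLogDeriv (hD : IsOpen D) (v : ℝ × ℝ) {c : ℝ × ℝ → ℝ}
    (hc : ContDiffOn ℝ ∞ c D) (h0 : ∀ z ∈ D, c z ≠ 0) {z : ℝ × ℝ} (hz : z ∈ D) :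
    dirDeriv v (halfLogDeriv v c) z =
      dirDeriv v (dirDeriv v c) z / (2 * c z) - dirDeriv v c z ^ 2 / (2 * c z ^ 2) := by
  have h1 := (contDiffOn_halfLogDeriv hD v hc h0).differentiableAt_of_isOpen hD hz
  have h2 := hc.differentiableAt_of_isOpen hD hz
  -- Differentiating the product `c_v = (c_v / 2c) · 2c` and solving for the wanted derivative
  -- replaces the quotient rule.
  have h3 : dirDeriv v (dirDeriv v c) z =
      dirDeriv v (fun w => halfLogDeriv v c w • (c w + c w)) z :=
    dirDeriv_congr hD v (fun w hw => by
      have := h0 w hw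
      simp only [halfLogDeriv, smul_eq_mul]
      field_simp
      ring) hz
  rw [dirDeriv_smul v h1 (h2.fun_add h2), dirDeriv_add v h2 h2] at h3
  have h4 := h0 z hz
  rw [h3]
  simp only [halfLogDeriv, smul_eq_mul]
  field_simp
  ring

end DirectionalDerivative

/-! ### Structure equations of the frame in one asymptotic direction. -/

section StructureEquations

variable {E : Type*} [NormedAddCommGroup E] [NormedSpace ℝ E] {D : Set (ℝ × ℝ)}
  {v w : ℝ × ℝ} {f f₁ f₂ η : ℝ × ℝ → E} {α β b c p q P Q k l : ℝ × ℝ → ℝ}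

/-- The structure equations of the Wilczynski frame in the asymptotic direction `v`, the other
asymptotic direction being `w`. -/
theorem structure_equations (hD : IsOpen D)
    (hf : ContDiffOn ℝ ∞ f D) (hα : ContDiffOn ℝ ∞ α D) (hβ : ContDiffOn ℝ ∞ β D)
    (hb : ContDiffOn ℝ ∞ b D) (hP : ContDiffOn ℝ ∞ P D) (hk : ContDiffOn ℝ ∞ k D)
    (hvv : ∀ z ∈ D, dirDeriv v (dirDeriv v f) z = b z • dirDeriv w f z + p z • f z)
    (hww : ∀ z ∈ D, dirDeriv w (dirDeriv w f) z = c z • dirDeriv v f z + q z • f z)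
    (hbβ : ∀ z ∈ D, dirDeriv w b z = 2 * β z * b z)
    (hf₁ : ∀ z ∈ D, f₁ z = dirDeriv v f z - α z • f z)
    (hf₂ : ∀ z ∈ D, f₂ z = dirDeriv w f z - β z • f z)
    (hη : ∀ z ∈ D, η z = dirDeriv w (dirDeriv v f) z - α z • dirDeriv w f z
      - β z • dirDeriv v f z + (α z * β z - b z * c z / 2) • f z)
    (hPp : ∀ z ∈ D, P z = p z + b z * β z - dirDeriv v α z - α z ^ 2)
    (hQq : ∀ z ∈ D, Q z = q z + c z * α z - dirDeriv w β z - β z ^ 2)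
    (hkα : ∀ z ∈ D, k z = b z * c z / 2 - dirDeriv w α z)
    (hlβ : ∀ z ∈ D, l z = b z * c z / 2 - dirDeriv v β z) {z : ℝ × ℝ} (hz : z ∈ D) :
    dirDeriv v f z = α z • f z + f₁ z ∧
    dirDeriv v f₁ z = P z • f z - α z • f₁ z + b z • f₂ z ∧
    dirDeriv v f₂ z = l z • f z + α z • f₂ z + η z ∧
    dirDeriv v η z = (dirDeriv w P z + b z * Q z - dirDeriv v k z - 2 * α z * k z) • f z
      + l z • f₁ z + P z • f₂ z - α z • η z := by
  have hfv := contDiffOn_dirDeriv hD v hf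
  have hfw := contDiffOn_dirDeriv hD w hf
  have s₁ : ContDiffOn ℝ ∞ f₁ D := (hfv.sub (hα.smul hf)).congr hf₁
  have s₂ : ContDiffOn ℝ ∞ f₂ D := (hfw.sub (hβ.smul hf)).congr hf₂
  have r {u : ℝ × ℝ → ℝ} (hu : ContDiffOn ℝ ∞ u D) {x : ℝ × ℝ} (hx : x ∈ D) :=
    hu.differentiableAt_of_isOpen hD hx
  have d {u : ℝ × ℝ → E} (hu : ContDiffOn ℝ ∞ u D) {x : ℝ × ℝ} (hx : x ∈ D) :=
    hu.differentiableAt_of_isOpen hD hx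
  have hfv_eq : ∀ x ∈ D, dirDeriv v f x = α x • f x + f₁ x := fun x hx => by
    rw [hf₁ x hx]; module
  have hfw_eq : ∀ x ∈ D, dirDeriv w f x = β x • f x + f₂ x := fun x hx => by
    rw [hf₂ x hx]; module
  have hf₁v : ∀ x ∈ D, dirDeriv v f₁ x = P x • f x - α x • f₁ x + b x • f₂ x := by
    intro x hx
    rw [dirDeriv_congr hD v hf₁ hx, dirDeriv_sub v (d hfv hx) ((r hα hx).fun_smul (d hf hx)),
      dirDeriv_smul v (r hα hx) (d hf hx), hvv x hx, hfv_eq x hx, hfw_eq x hx, hPp x hx]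
    module
  have hf₂w : ∀ x ∈ D, dirDeriv w f₂ x = Q x • f x - β x • f₂ x + c x • f₁ x := by
    intro x hx
    rw [dirDeriv_congr hD w hf₂ hx, dirDeriv_sub w (d hfw hx) ((r hβ hx).fun_smul (d hf hx)),
      dirDeriv_smul w (r hβ hx) (d hf hx), hww x hx, hfv_eq x hx, hfw_eq x hx, hQq x hx]
    module
  have hf₁w : ∀ x ∈ D, dirDeriv w f₁ x = k x • f x + β x • f₁ x + η x := by
    intro x hx
    rw [dirDeriv_congr hD w hf₁ hx, dirDeriv_sub w (d hfv hx) ((r hα hx).fun_smul (d hf hx)),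
      dirDeriv_smul w (r hα hx) (d hf hx), hη x hx, hfv_eq x hx, hfw_eq x hx, hkα x hx]
    module
  refine ⟨hfv_eq z hz, hf₁v z hz, ?_, ?_⟩
  · rw [dirDeriv_congr hD v hf₂ hz, dirDeriv_sub v (d hfw hz) ((r hβ hz).fun_smul (d hf hz)),
      dirDeriv_smul v (r hβ hz) (d hf hz), dirDeriv_comm hD v w hf hz, hη z hz, hfv_eq z hz,
      hfw_eq z hz, hlβ z hz]
    module
  -- Solving the equation for `∂_w f₁` for `η` leaves `∂_v ∂_w f₁` as the only second derivative.
  -- Swapping the order turns it into `∂_w` of the known expression for `∂_v f₁`.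
  · have hη' : ∀ x ∈ D, η x = dirDeriv w f₁ x - (k x • f x + β x • f₁ x) := fun x hx => by
      rw [hf₁w x hx]; module
    have dkf := (r hk hz).fun_smul (d hf hz)
    have dβf := (r hβ hz).fun_smul (d s₁ hz)
    have dPf := (r hP hz).fun_smul (d hf hz)
    have dαf := (r hα hz).fun_smul (d s₁ hz)
    have dbf := (r hb hz).fun_smul (d s₂ hz)
    rw [dirDeriv_congr hD v hη' hz,
      dirDeriv_sub v (d (contDiffOn_dirDeriv hD w s₁) hz) (dkf.fun_add dβf), dirDeriv_add v dkf dβf,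
      dirDeriv_smul v (r hk hz) (d hf hz), dirDeriv_smul v (r hβ hz) (d s₁ hz),
      dirDeriv_comm hD v w s₁ hz, dirDeriv_congr hD w hf₁v hz,
      dirDeriv_add w (dPf.fun_sub dαf) dbf, dirDeriv_sub w dPf dαf,
      dirDeriv_smul w (r hP hz) (d hf hz), dirDeriv_smul w (r hα hz) (d s₁ hz),
      dirDeriv_smul w (r hb hz) (d s₂ hz), hf₁v z hz, hf₂w z hz, hf₁w z hz, hfv_eq z hz,
      hfw_eq z hz, hbβ z hz, hlβ z hz, hkα z hz]
    module

end StructureEquations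

/-! ### Connection matrices and integrability. -/

section Connection

variable {D : Set (ℝ × ℝ)}

/-- The connection matrix of the Wilczynski frame in the `x`-direction. -/
def connX (α l b P A : ℝ) : Matrix (Fin 4) (Fin 4) ℝ :=
  !![α, P, l, A; 1, -α, 0, l; 0, b, α, P; 0, 0, 1, -α]

/-- The connection matrix of the Wilczynski frame in the `y`-direction. -/
def connY (β k c Q B : ℝ) : Matrix (Fin 4) (Fin 4) ℝ :=
  !![β, k, Q, B; 0, β, c, Q; 1, 0, -β, k; 0, 1, 0, -β]

theorem dirDeriv_apply (v : ℝ × ℝ) {u : ℝ × ℝ → Fin 4 → ℝ} {z : ℝ × ℝ}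
    (hu : DifferentiableAt ℝ u z) (i : Fin 4) :
    dirDeriv v (fun w => u w i) z = dirDeriv v u z i := by
  rw [dirDeriv, dirDeriv, fderiv_pi (differentiableAt_pi.1 hu)]
  rfl

theorem matDeriv_congr (hD : IsOpen D) (v : ℝ × ℝ)
    {φ ψ : ℝ × ℝ → Matrix (Fin 4) (Fin 4) ℝ} (h : ∀ z ∈ D, φ z = ψ z) {z : ℝ × ℝ} (hz : z ∈ D) :
    matDeriv φ z v = matDeriv ψ z v := by
  ext i j
  exact dirDeriv_congr hD v (fun w hw => congrFun (congrFun (h w hw) i) j) hz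

theorem matDeriv_comm (hD : IsOpen D) (v w : ℝ × ℝ)
    {φ : ℝ × ℝ → Matrix (Fin 4) (Fin 4) ℝ} (h : ∀ i j, ContDiffOn ℝ ∞ (fun z => φ z i j) D)
    {z : ℝ × ℝ} (hz : z ∈ D) :
    matDeriv (fun y => matDeriv φ y w) z v = matDeriv (fun y => matDeriv φ y v) z w := by
  ext i j
  exact dirDeriv_comm hD v w (h i j) hz

theorem differentiableAt_connX {α l b P A : ℝ × ℝ → ℝ} {z : ℝ × ℝ}
    (hα : DifferentiableAt ℝ α z) (hl : DifferentiableAt ℝ l z) (hb : DifferentiableAt ℝ b z)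
    (hP : DifferentiableAt ℝ P z) (hA : DifferentiableAt ℝ A z) (i j : Fin 4) :
    DifferentiableAt ℝ (fun y => connX (α y) (l y) (b y) (P y) (A y) i j) z := by
  fin_cases i <;> fin_cases j <;>
    first
    | exact differentiableAt_const _
    | assumption
    | exact hα.fun_neg

theorem differentiableAt_connY {β k c Q B : ℝ × ℝ → ℝ} {z : ℝ × ℝ}
    (hβ : DifferentiableAt ℝ β z) (hk : DifferentiableAt ℝ k z) (hc : DifferentiableAt ℝ c z)
    (hQ : DifferentiableAt ℝ Q z) (hB : DifferentiableAt ℝ B z) (i j : Fin 4) :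
    DifferentiableAt ℝ (fun y => connY (β y) (k y) (c y) (Q y) (B y) i j) z := by
  fin_cases i <;> fin_cases j <;>
    first
    | exact differentiableAt_const _
    | assumption
    | exact hβ.fun_neg

/-- The integrability conditions contained in the equation `V U + U_y = U V + V_x`. -/
theorem connection_integrability (hD : IsOpen D) {F : ℝ × ℝ → Matrix (Fin 4) (Fin 4) ℝ}
    {α β k l b c P Q A B : ℝ × ℝ → ℝ} (hF : ∀ i j, ContDiffOn ℝ ∞ (fun z => F z i j) D)
    (hdet : ∀ z ∈ D, (F z).det = 1)
    (hx : ∀ z ∈ D, matDeriv F z (1, 0) = F z * connX (α z) (l z) (b z) (P z) (A z))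
    (hy : ∀ z ∈ D, matDeriv F z (0, 1) = F z * connY (β z) (k z) (c z) (Q z) (B z))
    {z : ℝ × ℝ} (hz : z ∈ D)
    (dα : DifferentiableAt ℝ α z) (dβ : DifferentiableAt ℝ β z) (dk : DifferentiableAt ℝ k z)
    (dl : DifferentiableAt ℝ l z) (db : DifferentiableAt ℝ b z) (dc : DifferentiableAt ℝ c z)
    (dP : DifferentiableAt ℝ P z) (dQ : DifferentiableAt ℝ Q z) (dA : DifferentiableAt ℝ A z)
    (dB : DifferentiableAt ℝ B z) :
    A z + dY P z = b z * Q z + 2 * α z * k z + dX k z ∧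
      B z + dX Q z = c z * P z + 2 * β z * l z + dY l z := by
  have dF : ∀ i j, DifferentiableAt ℝ (fun w => F w i j) z := fun i j =>
    (hF i j).differentiableAt_of_isOpen hD hz
  have hu : IsUnit (F z).det := by simp [hdet z hz]
  have h := matDeriv_comm hD (0, 1) (1, 0) hF hz
  rw [matDeriv_congr hD _ hx hz, matDeriv_congr hD _ hy hz,
    matDeriv_mul _ dF (differentiableAt_connX dα dl db dP dA),
    matDeriv_mul _ dF (differentiableAt_connY dβ dk dc dQ dB), hx z hz, hy z hz,
    Matrix.mul_assoc, Matrix.mul_assoc, ← Matrix.mul_add, ← Matrix.mul_add] at h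
  have h' := congrArg ((F z)⁻¹ * ·) h
  simp only [Matrix.nonsing_inv_mul_cancel_left _ _ hu] at h'
  -- Counting from zero, entry (1,3) carries the equation with `B` and `Q_x`, and entry (2,3) the
  -- one with `A` and `P_y`.
  have h1 := congrFun (congrFun h' 1) 3
  have h2 := congrFun (congrFun h' 2) 3
  simp [connX, connY, matDeriv] at h1 h2
  simp only [dX, dY]
  constructor <;> linarith

/-- The structure equations of the Wilczynski frame, with their integrability conditions. -/
theorem IsCanonicalSurface.exists_connection (hD : IsOpen D) {f : ℝ × ℝ → Fin 4 → ℝ}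
    {b c p q : ℝ × ℝ → ℝ} (hS : IsCanonicalSurface D f b c p q) :
    (∀ i j, ContDiffOn ℝ ∞ (fun z => wilczynskiFrame f b c z i j) D) ∧
    ∃ α β k l : ℝ × ℝ → ℝ, ContDiffOn ℝ ∞ α D ∧ ContDiffOn ℝ ∞ β D ∧ ContDiffOn ℝ ∞ k D ∧
      ContDiffOn ℝ ∞ l D ∧ ContDiffOn ℝ ∞ (invP b c p) D ∧ ContDiffOn ℝ ∞ (invQ b c q) D ∧
      ∀ z ∈ D, dX c z = 2 * α z * c z ∧ dY b z = 2 * β z * b z ∧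
        matDeriv (wilczynskiFrame f b c) z (1, 0) = wilczynskiFrame f b c z *
          connX (α z) (l z) (b z) (invP b c p z) (b z * invQ b c q z) ∧
        matDeriv (wilczynskiFrame f b c) z (0, 1) = wilczynskiFrame f b c z *
          connY (β z) (k z) (c z) (invQ b c q z) (c z * invP b c p z) ∧
        dY (invP b c p) z = dX k z + 2 * α z * k z ∧
        dX (invQ b c q) z = dY l z + 2 * β z * l z := by
  obtain ⟨hf, hb, hc, hp, hq, hxx, hyy, hbc, hdet⟩ := hS
  have hb0 : ∀ z ∈ D, b z ≠ 0 := fun z hz => left_ne_zero_of_mul (hbc z hz)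
  have hc0 : ∀ z ∈ D, c z ≠ 0 := fun z hz => right_ne_zero_of_mul (hbc z hz)
  set α := halfLogDeriv (1, 0) c with hα_def
  set β := halfLogDeriv (0, 1) b with hβ_def
  have hα : ContDiffOn ℝ ∞ α D := contDiffOn_halfLogDeriv hD _ hc hc0
  have hβ : ContDiffOn ℝ ∞ β D := contDiffOn_halfLogDeriv hD _ hb hb0
  have hcα : ∀ z ∈ D, dirDeriv (1, 0) c z = 2 * α z * c z := fun z hz => by
    have := hc0 z hz
    simp only [hα_def, halfLogDeriv]
    field_simp
  have hbβ : ∀ z ∈ D, dirDeriv (0, 1) b z = 2 * β z * b z := fun z hz => by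
    have := hb0 z hz
    simp only [hβ_def, halfLogDeriv]
    field_simp
  set k : ℝ × ℝ → ℝ := fun z => b z * c z / 2 - dirDeriv (0, 1) α z
  set l : ℝ × ℝ → ℝ := fun z => b z * c z / 2 - dirDeriv (1, 0) β z
  have hk : ContDiffOn ℝ ∞ k D :=
    ((hb.mul hc).div_const 2).sub (contDiffOn_dirDeriv hD _ hα)
  have hl : ContDiffOn ℝ ∞ l D :=
    ((hb.mul hc).div_const 2).sub (contDiffOn_dirDeriv hD _ hβ)
  -- This is the form in which `P` appears in `structure_equations`: `b_y/2 = bβ` and `c_xx/2c -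
  -- c_x²/4c² = α_x + α²`.
  have hPp : ∀ z ∈ D, invP b c p z = p z + b z * β z - dirDeriv (1, 0) α z - α z ^ 2 := by
    intro z hz
    have h1 := hb0 z hz
    have h2 := hc0 z hz
    rw [hα_def, dirDeriv_halfLogDeriv hD _ hc hc0 hz]
    change p z + dirDeriv (0, 1) b z / 2 - dirDeriv (1, 0) (dirDeriv (1, 0) c) z / (2 * c z) +
      dirDeriv (1, 0) c z ^ 2 / (4 * c z ^ 2) = _
    rw [hbβ z hz]
    simp only [halfLogDeriv]
    field_simp
    ring
  have hQq : ∀ z ∈ D, invQ b c q z = q z + c z * α z - dirDeriv (0, 1) β z - β z ^ 2 := by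
    intro z hz
    have h1 := hb0 z hz
    have h2 := hc0 z hz
    rw [hβ_def, dirDeriv_halfLogDeriv hD _ hb hb0 hz]
    change q z + dirDeriv (1, 0) c z / 2 - dirDeriv (0, 1) (dirDeriv (0, 1) b) z / (2 * b z) +
      dirDeriv (0, 1) b z ^ 2 / (4 * b z ^ 2) = _
    rw [hcα z hz]
    simp only [halfLogDeriv]
    field_simp
    ring
  have hP : ContDiffOn ℝ ∞ (invP b c p) D :=
    (((hp.add (hb.mul hβ)).sub (contDiffOn_dirDeriv hD _ hα)).sub (hα.pow 2)).congr hPp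
  have hQ : ContDiffOn ℝ ∞ (invQ b c q) D :=
    (((hq.add (hc.mul hα)).sub (contDiffOn_dirDeriv hD _ hβ)).sub (hβ.pow 2)).congr hQq
  have hη : ∀ z ∈ D, frameEta f b c z = dirDeriv (0, 1) (dirDeriv (1, 0) f) z
      - α z • dirDeriv (0, 1) f z - β z • dirDeriv (1, 0) f z
      + (α z * β z - b z * c z / 2) • f z := by
    intro z hz
    have : dY b z * dX c z / (4 * b z * c z) = α z * β z := by
      simp only [hα_def, hβ_def, halfLogDeriv, dX, dY, dirDeriv]
      have h1 := hb0 z hz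
      have h2 := hc0 z hz
      field_simp
      norm_num
    rw [frameEta, this]
    rfl
  have hη' : ∀ z ∈ D, frameEta f b c z = dirDeriv (1, 0) (dirDeriv (0, 1) f) z
      - β z • dirDeriv (1, 0) f z - α z • dirDeriv (0, 1) f z
      + (β z * α z - c z * b z / 2) • f z := by
    intro z hz
    rw [hη z hz, dirDeriv_comm hD _ _ hf hz]
    module
  have sx := fun z hz => structure_equations (z := z) (f₁ := frameOne f c) (f₂ := frameTwo f b)
    (k := k) (l := l) hD hf hα hβ hb hP hk hxx hyy hbβ (fun _ _ => rfl) (fun _ _ => rfl) hη hPp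
    hQq (fun _ _ => rfl) (fun _ _ => rfl) hz
  -- The configuration is symmetric under exchanging `x` with `y`, together with `f₁, b, α, k, P`
  -- with `f₂, c, β, l, Q`; `η` is invariant by equality of mixed derivatives.
  have sy := fun z hz => structure_equations (z := z) (f₁ := frameTwo f b) (f₂ := frameOne f c)
    (k := l) (l := k) hD hf hβ hα hc hQ hl hyy hxx hcα (fun _ _ => rfl) (fun _ _ => rfl) hη' hQq
    hPp (fun x _ => by simp only [l]; ring) (fun x _ => by simp only [k]; ring) hz
  have hfx := contDiffOn_dirDeriv hD (1, 0) hf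
  have hfy := contDiffOn_dirDeriv hD (0, 1) hf
  have s1 : ContDiffOn ℝ ∞ (frameOne f c) D := hfx.sub (hα.smul hf)
  have s2 : ContDiffOn ℝ ∞ (frameTwo f b) D := hfy.sub (hβ.smul hf)
  have s3 : ContDiffOn ℝ ∞ (frameEta f b c) D :=
    ((((contDiffOn_dirDeriv hD (0, 1) hfx).sub (hα.smul hfy)).sub (hβ.smul hfx)).add
      (((hα.mul hβ).sub ((hb.mul hc).div_const 2)).smul hf)).congr hη
  have hF : ∀ i j, ContDiffOn ℝ ∞ (fun z => wilczynskiFrame f b c z i j) D := by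
    intro i j
    fin_cases j
    · exact contDiffOn_pi.1 hf i
    · exact contDiffOn_pi.1 s1 i
    · exact contDiffOn_pi.1 s2 i
    · exact contDiffOn_pi.1 s3 i
  set P := invP b c p
  set Q := invQ b c q
  set A : ℝ × ℝ → ℝ := fun z =>
    dirDeriv (0, 1) P z + b z * Q z - dirDeriv (1, 0) k z - 2 * α z * k z with hA_def
  set B : ℝ × ℝ → ℝ := fun z =>
    dirDeriv (1, 0) Q z + c z * P z - dirDeriv (0, 1) l z - 2 * β z * l z with hB_def
  have hA : ContDiffOn ℝ ∞ A D :=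
    (((contDiffOn_dirDeriv hD _ hP).add (hb.mul hQ)).sub (contDiffOn_dirDeriv hD _ hk)).sub
      ((contDiffOn_const.mul hα).mul hk)
  have hB : ContDiffOn ℝ ∞ B D :=
    (((contDiffOn_dirDeriv hD _ hQ).add (hc.mul hP)).sub (contDiffOn_dirDeriv hD _ hl)).sub
      ((contDiffOn_const.mul hβ).mul hl)
  have hcol : ∀ v : ℝ × ℝ, ∀ z ∈ D, matDeriv (wilczynskiFrame f b c) z v =
      (Matrix.of ![dirDeriv v f z, dirDeriv v (frameOne f c) z, dirDeriv v (frameTwo f b) z,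
        dirDeriv v (frameEta f b c) z])ᵀ := by
    intro v z hz
    ext i j
    fin_cases j
    · exact dirDeriv_apply v (hf.differentiableAt_of_isOpen hD hz) i
    · exact dirDeriv_apply v (s1.differentiableAt_of_isOpen hD hz) i
    · exact dirDeriv_apply v (s2.differentiableAt_of_isOpen hD hz) i
    · exact dirDeriv_apply v (s3.differentiableAt_of_isOpen hD hz) i
  have hx : ∀ z ∈ D, matDeriv (wilczynskiFrame f b c) z (1, 0) = wilczynskiFrame f b c z *
      connX (α z) (l z) (b z) (P z) (A z) := by
    intro z hz
    obtain ⟨e0, e1, e2, e3⟩ := sx z hz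
    rw [hcol _ z hz, e0, e1, e2, e3]
    ext i j
    fin_cases j <;>
      simp [wilczynskiFrame, connX, Matrix.mul_apply, Fin.sum_univ_four, A] <;> ring
  have hy : ∀ z ∈ D, matDeriv (wilczynskiFrame f b c) z (0, 1) = wilczynskiFrame f b c z *
      connY (β z) (k z) (c z) (Q z) (B z) := by
    intro z hz
    obtain ⟨e0, e1, e2, e3⟩ := sy z hz
    rw [hcol _ z hz, e0, e1, e2, e3]
    ext i j
    fin_cases j <;>
      simp [wilczynskiFrame, connY, Matrix.mul_apply, Fin.sum_univ_four, B] <;> ring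
  refine ⟨hF, α, β, k, l, hα, hβ, hk, hl, hP, hQ, fun z hz => ?_⟩
  have r {u : ℝ × ℝ → ℝ} (hu : ContDiffOn ℝ ∞ u D) := hu.differentiableAt_of_isOpen hD hz
  obtain ⟨i1, i2⟩ := connection_integrability hD hF hdet hx hy hz (r hα) (r hβ) (r hk) (r hl)
    (r hb) (r hc) (r hP) (r hQ) (r hA) (r hB)
  have hAz : A z = dY P z + b z * Q z - dX k z - 2 * α z * k z := rfl
  have hBz : B z = dX Q z + c z * P z - dY l z - 2 * β z * l z := rfl
  -- The definition gives `A - P_y = bQ - k_x - 2αk` and integrability gives `A + P_y = bQ + k_x +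
  -- 2αk`. The sum yields `A = bQ`, the difference the equation for `P_y`. The same holds for `B`.
  have hA' : A z = b z * Q z := by linarith
  have hB' : B z = c z * P z := by linarith
  refine ⟨hcα z hz, hbβ z hz, ?_, ?_, by linarith, by linarith⟩
  · rw [hx z hz, hA']
  · rw [hy z hz, hB']

end Connection

/-! ### The space of quadrics in a moving frame. -/

section SymmetricSpace

theorem matJ1_mul_self : matJ1 * matJ1 = 1 := by
  ext i j
  fin_cases i <;> fin_cases j <;> simp [matJ1]

theorem transpose_matJ1 : matJ1ᵀ = matJ1 := by
  ext i j
  fin_cases i <;> fin_cases j <;> rfl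

theorem matJ2_mul_self : matJ2 * matJ2 = 1 := by
  ext i j
  fin_cases i <;> fin_cases j <;> simp [matJ2]

theorem det_matJ1 : matJ1.det = 1 := by
  simp [matJ1, Matrix.det_succ_row_zero, Fin.sum_univ_succ, Fin.succAbove]
  norm_num

theorem toQuadraticForm'_apply_transpose_mul_diagonal_mul {n : Type*} [Fintype n] [DecidableEq n]
    (T : Matrix n n ℝ) (w x : n → ℝ) :
    (Tᵀ * Matrix.diagonal w * T).toQuadraticForm' x = ∑ i, w i * ((T *ᵥ x) i * (T *ᵥ x) i) := by
  have : (Tᵀ * Matrix.diagonal w * T).toQuadraticForm' x =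
      x ⬝ᵥ (Tᵀ * Matrix.diagonal w * T) *ᵥ x := by
    simp [Matrix.toQuadraticForm', Matrix.toLinearMap₂'_apply']
  rw [this, ← Matrix.mulVec_mulVec, ← Matrix.mulVec_mulVec, Matrix.dotProduct_mulVec,
    Matrix.vecMul_transpose, dotProduct]
  simp only [Matrix.mulVec_diagonal]
  exact Finset.sum_congr rfl fun i _ => by ring

/-- A matrix congruent to a diagonal matrix gives a quadratic form equivalent to a weighted sum of
squares. -/
theorem equivalent_weightedSumSquares_of_transpose_mul_diagonal_mul {n : Type*} [Fintype n]
    [DecidableEq n] {T : Matrix n n ℝ} (hT : IsUnit T.det) (w : n → ℝ) :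
    (Tᵀ * Matrix.diagonal w * T).toQuadraticForm'.Equivalent
      (QuadraticMap.weightedSumSquares ℝ w) := by
  have hinv := (Matrix.isUnit_iff_isUnit_det T).2 hT
  refine ⟨⟨LinearEquiv.ofBijective (Matrix.mulVecLin T) ?_, fun x => ?_⟩⟩
  · exact ⟨Matrix.mulVec_injective_iff_isUnit.2 hinv, Matrix.mulVec_surjective_iff_isUnit.2 hinv⟩
  · rw [toQuadraticForm'_apply_transpose_mul_diagonal_mul]
    simp only [QuadraticMap.weightedSumSquares_apply, smul_eq_mul]
    rfl

/-- Congruence preserves the signature, so diagonalizing `J₁` suffices. -/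
theorem mul_matJ1_mul_transpose_mem_quadricSpace {F : Matrix (Fin 4) (Fin 4) ℝ} (hF : F.det = 1) :
    F * matJ1 * Fᵀ ∈ quadricSpace := by
  -- The rows of `K` are the sums and differences in `2x₀x₃ + 2x₁x₂ = ((x₀+x₃)² + (x₁+x₂)² -
  -- (x₀-x₃)² - (x₁-x₂)²) / 2`.
  set K : Matrix (Fin 4) (Fin 4) ℝ := !![1, 0, 0, 1; 0, 1, 1, 0; 1, 0, 0, -1; 0, 1, -1, 0] with hK
  set w : Fin 4 → ℝ := ![1 / 2, 1 / 2, -1 / 2, -1 / 2] with hw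
  have hJ : matJ1 = Kᵀ * Matrix.diagonal w * K := by
    ext i j
    fin_cases i <;> fin_cases j <;>
      simp [matJ1, hK, hw, Matrix.mul_apply, Fin.sum_univ_four, Matrix.diagonal_apply] <;> norm_num
  have hKdet : K.det = -4 := by
    simp [hK, Matrix.det_succ_row_zero, Fin.sum_univ_succ, Fin.succAbove]
    norm_num
  have hT : F * matJ1 * Fᵀ = (K * Fᵀ)ᵀ * Matrix.diagonal w * (K * Fᵀ) := by
    rw [hJ, Matrix.transpose_mul, Matrix.transpose_transpose]
    simp only [Matrix.mul_assoc]
  have he : (F * matJ1 * Fᵀ).toQuadraticForm'.Equivalent (QuadraticMap.weightedSumSquares ℝ w) := by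
    rw [hT]
    exact equivalent_weightedSumSquares_of_transpose_mul_diagonal_mul (by simp [hKdet, hF]) w
  refine ⟨?_, by simp [hF, det_matJ1], ?_, ?_⟩
  · rw [hT, Matrix.IsSymm]
    simp [Matrix.mul_assoc]
  · rw [QuadraticForm.sigPos_of_equiv_weightedSumSquares he]
    have : {i | 0 < w i} = (({0, 1} : Finset (Fin 4)) : Set (Fin 4)) := by
      ext i; fin_cases i <;> simp [hw]
    rw [this, Set.ncard_coe_finset]
    rfl
  · rw [QuadraticForm.sigNeg_of_equiv_weightedSumSquares he]
    have : {i | w i < 0} = (({2, 3} : Finset (Fin 4)) : Set (Fin 4)) := by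
      ext i; fin_cases i <;> simp [hw] <;> norm_num
    rw [this, Set.ncard_coe_finset]
    rfl

variable {D : Set (ℝ × ℝ)} {F U V S T : ℝ × ℝ → Matrix (Fin 4) (Fin 4) ℝ}
  {J : Matrix (Fin 4) (Fin 4) ℝ} {z v w : ℝ × ℝ}

theorem matDeriv_transpose (φ : ℝ × ℝ → Matrix (Fin 4) (Fin 4) ℝ) :
    matDeriv (fun y => (φ y)ᵀ) z v = (matDeriv φ z v)ᵀ := rfl

theorem matDeriv_const (M : Matrix (Fin 4) (Fin 4) ℝ) : matDeriv (fun _ => M) z v = 0 := by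
  ext i j
  simp [matDeriv]

/-- The derivative of `F S Fᵗ` in a direction in which `F` has the derivative `F U`. -/
theorem matDeriv_mul_mul_transpose {U : Matrix (Fin 4) (Fin 4) ℝ}
    (hF : ∀ i j, DifferentiableAt ℝ (fun y => F y i j) z)
    (hS : ∀ i j, DifferentiableAt ℝ (fun y => S y i j) z) (hU : matDeriv F z v = F z * U) :
    matDeriv (fun y => F y * S y * (F y)ᵀ) z v =
      F z * (U * S z + matDeriv S z v + S z * Uᵀ) * (F z)ᵀ := by
  have hFt : ∀ i j, DifferentiableAt ℝ (fun y => (F y)ᵀ i j) z := fun i j => hF j i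
  rw [matDeriv_mul v (differentiableAt_matMul hF hS) hFt, matDeriv_mul v hF hS,
    matDeriv_transpose, hU, Matrix.transpose_mul]
  noncomm_ring

theorem inv_mul_mul_transpose {F J : Matrix (Fin 4) (Fin 4) ℝ} (hJ : J * J = 1) :
    (F * J * Fᵀ)⁻¹ = F⁻¹ᵀ * J * F⁻¹ := by
  rw [Matrix.mul_inv_rev, Matrix.mul_inv_rev, Matrix.inv_eq_right_inv hJ,
    Matrix.transpose_nonsing_inv, Matrix.mul_assoc]

/-- Invariance of the metric under `m ↦ F m Fᵗ` moves the computation to the base point `J`, which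
is its own inverse. -/
theorem quadricMetric_mul_mul_transpose {F J X Y : Matrix (Fin 4) (Fin 4) ℝ} (hJ : J * J = 1)
    (hF : F.det = 1) :
    quadricMetric (F * J * Fᵀ) (F * X * Fᵀ) (F * Y * Fᵀ) = (J * X * J * Y).trace := by
  have hu : IsUnit F.det := by simp [hF]
  have hu' : IsUnit Fᵀ.det := by simp [hF]
  have : F⁻¹ᵀ * J * F⁻¹ * (F * X * Fᵀ) * (F⁻¹ᵀ * J * F⁻¹) * (F * Y * Fᵀ) =
      F⁻¹ᵀ * (J * X * J * Y * Fᵀ) := by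
    simp only [Matrix.mul_assoc, Matrix.transpose_nonsing_inv,
      Matrix.nonsing_inv_mul_cancel_left _ _ hu, Matrix.mul_nonsing_inv_cancel_left _ _ hu']
  rw [quadricMetric, inv_mul_mul_transpose hJ, this, Matrix.trace_mul_comm,
    Matrix.transpose_nonsing_inv, Matrix.mul_nonsing_inv_cancel_right _ _ hu']

/-- The covariant derivative of `F T Fᵗ` along `F J Fᵗ`, where `K` is the component of the
connection matrix `U` that is skew with respect to `J`. -/
theorem covDeriv_mul_mul_transpose {U K : Matrix (Fin 4) (Fin 4) ℝ} (hJ : J * J = 1)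
    (hJt : Jᵀ = J) (hF : ∀ i j, DifferentiableAt ℝ (fun y => F y i j) z)
    (hT : ∀ i j, DifferentiableAt ℝ (fun y => T y i j) z) (hdet : (F z).det = 1)
    (hU : matDeriv F z v = F z * U) (hK : J * Uᵀ * J = U - (2 : ℝ) • K) :
    covDeriv (fun y => F y * J * (F y)ᵀ) (fun y => F y * T y * (F y)ᵀ) z v =
      F z * (K * T z + matDeriv T z v + T z * Kᵀ) * (F z)ᵀ := by
  have hu : IsUnit (F z).det := by simp [hdet]
  have hu' : IsUnit (F z)ᵀ.det := by simp [hdet]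
  set S := U * J + J * Uᵀ with hS
  have h1 := matDeriv_mul_mul_transpose (S := fun _ => J) (v := v) hF
    (fun i j => differentiableAt_const _) hU
  rw [matDeriv_const, add_zero, ← hS] at h1
  have h2 : ∀ X Y : Matrix (Fin 4) (Fin 4) ℝ,
      F z * X * (F z)ᵀ * ((F z)⁻¹ᵀ * J * (F z)⁻¹) * (F z * Y * (F z)ᵀ) =
        F z * (X * J * Y) * (F z)ᵀ := by
    intro X Y
    simp only [Matrix.mul_assoc, Matrix.transpose_nonsing_inv,
      Matrix.nonsing_inv_mul_cancel_left _ _ hu, Matrix.mul_nonsing_inv_cancel_left _ _ hu']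
  -- `hK` says `K = (U - J Uᵗ J) / 2`, so `S J` is twice the `J`-symmetric part of `U`. The
  -- Christoffel term therefore removes this part from `U`, leaving `K`.
  have hSJ : S * J = (2 : ℝ) • (U - K) := by
    rw [hS, Matrix.add_mul, Matrix.mul_assoc, hJ, Matrix.mul_one, hK]
    module
  have hJS : J * S = (2 : ℝ) • (Uᵀ - Kᵀ) := by
    have hSt : Sᵀ = S := by
      rw [hS, Matrix.transpose_add, Matrix.transpose_mul, Matrix.transpose_mul,
        Matrix.transpose_transpose, hJt, add_comm]
    have := congrArg Matrix.transpose hSJ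
    rwa [Matrix.transpose_mul, hJt, hSt, Matrix.transpose_smul, Matrix.transpose_sub] at this
  rw [covDeriv, matDeriv_mul_mul_transpose hF hT hU, h1, inv_mul_mul_transpose hJ, h2, h2, hSJ,
    Matrix.mul_assoc (T z), hJS, ← Matrix.add_mul, ← Matrix.mul_add, ← Matrix.smul_mul,
    ← Matrix.mul_smul, ← Matrix.sub_mul, ← Matrix.mul_sub]
  congr 2
  simp only [Matrix.smul_mul, Matrix.mul_smul, Matrix.sub_mul, Matrix.mul_sub]
  module

end SymmetricSpace

/-! ### Conformality and harmonicity of the first-order Gauss map. -/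

section FirstOrderGaussMap

variable {D : Set (ℝ × ℝ)} {f : ℝ × ℝ → Fin 4 → ℝ} {b c p q : ℝ × ℝ → ℝ}

/-- The matrix `U J₁ + J₁ Uᵗ` for the connection matrix `U` in the `x`-direction. -/
def gaussX (l b P A : ℝ) : Matrix (Fin 4) (Fin 4) ℝ :=
  !![2 * A, 2 * l, 2 * P, 0; 2 * l, 0, 0, 2; 2 * P, 0, 2 * b, 0; 0, 2, 0, 0]

/-- The matrix `V J₁ + J₁ Vᵗ` for the connection matrix `V` in the `y`-direction. -/
def gaussY (k c Q B : ℝ) : Matrix (Fin 4) (Fin 4) ℝ :=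
  !![2 * B, 2 * Q, 2 * k, 0; 2 * Q, 2 * c, 0, 0; 2 * k, 0, 0, 2; 0, 0, 2, 0]

theorem connX_transpose (α l b P A : ℝ) :
    (connX α l b P A)ᵀ = !![α, 1, 0, 0; P, -α, b, 0; l, 0, α, 1; A, l, P, -α] := by
  ext i j
  fin_cases i <;> fin_cases j <;> simp [connX]

theorem connY_transpose (β k c Q B : ℝ) :
    (connY β k c Q B)ᵀ = !![β, 0, 1, 0; k, β, 0, 1; Q, c, -β, 0; B, Q, k, -β] := by
  ext i j
  fin_cases i <;> fin_cases j <;> simp [connY]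

theorem gaussX_eq (α l b P A : ℝ) :
    gaussX l b P A = connX α l b P A * matJ1 + matJ1 * (connX α l b P A)ᵀ := by
  rw [connX_transpose]
  ext i j
  fin_cases i <;> fin_cases j <;> simp [gaussX, connX, matJ1] <;> ring

theorem gaussY_eq (β k c Q B : ℝ) :
    gaussY k c Q B = connY β k c Q B * matJ1 + matJ1 * (connY β k c Q B)ᵀ := by
  rw [connY_transpose]
  ext i j
  fin_cases i <;> fin_cases j <;> simp [gaussY, connY, matJ1] <;> ring

/-- This is the squared length of `∂_x g₁` at the base point; the contributions of `l`, `b` and `A`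
drop out, so nullity of the `x`-direction is the equation `P = 0`. -/
theorem trace_gaussX (l b P A : ℝ) :
    (matJ1 * gaussX l b P A * matJ1 * gaussX l b P A).trace = 16 * P := by
  have h : matJ1 * gaussX l b P A =
      !![0, 2, 0, 0; 2 * P, 0, 2 * b, 0; 2 * l, 0, 0, 2; 2 * A, 2 * l, 2 * P, 0] := by
    ext i j
    fin_cases i <;> fin_cases j <;> simp [gaussX, matJ1]
  rw [Matrix.mul_assoc (matJ1 * _), h, Matrix.trace]
  simp only [Matrix.diag_apply, Matrix.mul_apply, Fin.sum_univ_four]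
  simp
  ring

theorem trace_gaussY (k c Q B : ℝ) :
    (matJ1 * gaussY k c Q B * matJ1 * gaussY k c Q B).trace = 16 * Q := by
  have h : matJ1 * gaussY k c Q B =
      !![0, 0, 2, 0; 2 * k, 0, 0, 2; 2 * Q, 2 * c, 0, 0; 2 * B, 2 * Q, 2 * k, 0] := by
    ext i j
    fin_cases i <;> fin_cases j <;> simp [gaussY, matJ1]
  rw [Matrix.mul_assoc (matJ1 * _), h, Matrix.trace]
  simp only [Matrix.diag_apply, Matrix.mul_apply, Fin.sum_univ_four]
  simp
  ring

theorem quadricMetric_comm (m X Y : Matrix (Fin 4) (Fin 4) ℝ) :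
    quadricMetric m X Y = quadricMetric m Y X := by
  rw [quadricMetric, quadricMetric, Matrix.mul_assoc, Matrix.trace_mul_comm]
  simp only [Matrix.mul_assoc]

theorem matDeriv_eq_smul_add_smul (φ : ℝ × ℝ → Matrix (Fin 4) (Fin 4) ℝ) (z v : ℝ × ℝ) :
    matDeriv φ z v = v.1 • matDeriv φ z (1, 0) + v.2 • matDeriv φ z (0, 1) := by
  ext i j
  have : v = v.1 • ((1, 0) : ℝ × ℝ) + v.2 • ((0, 1) : ℝ × ℝ) := by ext <;> simp
  simp only [matDeriv, Matrix.of_apply, Matrix.add_apply, Matrix.smul_apply]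
  conv_lhs => rw [this, map_add, map_smul, map_smul]

theorem quadricMetric_expand (m X Y : Matrix (Fin 4) (Fin 4) ℝ) (v w : ℝ × ℝ) :
    quadricMetric m (v.1 • X + v.2 • Y) (w.1 • X + w.2 • Y) =
      v.1 * w.1 * quadricMetric m X X + v.2 * w.2 * quadricMetric m Y Y
        + quadricMetric m X Y * (v.1 * w.2 + v.2 * w.1) := by
  have h := quadricMetric_comm m X Y
  simp only [quadricMetric, Matrix.mul_add, Matrix.add_mul, Matrix.mul_smul, Matrix.smul_mul,
    Matrix.trace_add, Matrix.trace_smul, smul_eq_mul] at h ⊢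
  rw [h]
  ring

/-- A map is conformal exactly when both coordinate directions are null for the pulled back
metric. -/
theorem isLorentzConformal_iff (φ : ℝ × ℝ → Matrix (Fin 4) (Fin 4) ℝ) :
    IsLorentzConformal D φ ↔ ∀ z ∈ D,
      quadricMetric (φ z) (matDeriv φ z (1, 0)) (matDeriv φ z (1, 0)) = 0 ∧
        quadricMetric (φ z) (matDeriv φ z (0, 1)) (matDeriv φ z (0, 1)) = 0 := by
  constructor
  · rintro ⟨ρ, h⟩ z hz
    rw [h z hz, h z hz]
    simp
  · intro h
    refine ⟨fun z => quadricMetric (φ z) (matDeriv φ z (1, 0)) (matDeriv φ z (0, 1)),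
      fun z hz v w => ?_⟩
    rw [matDeriv_eq_smul_add_smul φ z v, matDeriv_eq_smul_add_smul φ z w, quadricMetric_expand,
      (h z hz).1, (h z hz).2]
    ring

theorem covDeriv_congr (hD : IsOpen D) (v : ℝ × ℝ) {φ Y Y' : ℝ × ℝ → Matrix (Fin 4) (Fin 4) ℝ}
    (h : ∀ z ∈ D, Y z = Y' z) {z : ℝ × ℝ} (hz : z ∈ D) :
    covDeriv φ Y z v = covDeriv φ Y' z v := by
  rw [covDeriv, covDeriv, matDeriv_congr hD v h hz, h z hz]

theorem differentiableAt_gaussX {l b P A : ℝ × ℝ → ℝ} {z : ℝ × ℝ} (hl : DifferentiableAt ℝ l z)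
    (hb : DifferentiableAt ℝ b z) (hP : DifferentiableAt ℝ P z) (hA : DifferentiableAt ℝ A z)
    (i j : Fin 4) :
    DifferentiableAt ℝ (fun y => gaussX (l y) (b y) (P y) (A y) i j) z := by
  fin_cases i <;> fin_cases j <;>
    first
    | exact differentiableAt_const _
    | exact DifferentiableAt.const_mul (by assumption) 2

theorem differentiableAt_gaussY {k c Q B : ℝ × ℝ → ℝ} {z : ℝ × ℝ} (hk : DifferentiableAt ℝ k z)
    (hc : DifferentiableAt ℝ c z) (hQ : DifferentiableAt ℝ Q z) (hB : DifferentiableAt ℝ B z)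
    (i j : Fin 4) :
    DifferentiableAt ℝ (fun y => gaussY (k y) (c y) (Q y) (B y) i j) z := by
  fin_cases i <;> fin_cases j <;>
    first
    | exact differentiableAt_const _
    | exact DifferentiableAt.const_mul (by assumption) 2

theorem matDeriv_gaussX_zero {l b : ℝ × ℝ → ℝ} {z : ℝ × ℝ} (hl : DifferentiableAt ℝ l z)
    (hb : DifferentiableAt ℝ b z) (v : ℝ × ℝ) :
    matDeriv (fun y => gaussX (l y) (b y) 0 0) z v =
      !![0, 2 * fderiv ℝ l z v, 0, 0; 2 * fderiv ℝ l z v, 0, 0, 0;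
        0, 0, 2 * fderiv ℝ b z v, 0; 0, 0, 0, 0] := by
  ext i j
  fin_cases i <;> fin_cases j <;> simp [matDeriv, gaussX, fderiv_const_mul hl, fderiv_const_mul hb]

theorem matDeriv_gaussY_zero {k c : ℝ × ℝ → ℝ} {z : ℝ × ℝ} (hk : DifferentiableAt ℝ k z)
    (hc : DifferentiableAt ℝ c z) (v : ℝ × ℝ) :
    matDeriv (fun y => gaussY (k y) (c y) 0 0) z v =
      !![0, 0, 2 * fderiv ℝ k z v, 0; 0, 2 * fderiv ℝ c z v, 0, 0;
        2 * fderiv ℝ k z v, 0, 0, 0; 0, 0, 0, 0] := by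
  ext i j
  fin_cases i <;> fin_cases j <;> simp [matDeriv, gaussY, fderiv_const_mul hk, fderiv_const_mul hc]

/-- The off-diagonal part of `U` is `J₁`-symmetric and its diagonal is `J₁`-skew, so only the
diagonal enters the covariant derivative. -/
theorem matJ1_mul_connX_transpose_mul (α l b P A : ℝ) :
    matJ1 * (connX α l b P A)ᵀ * matJ1 =
      connX α l b P A - (2 : ℝ) • Matrix.diagonal ![α, -α, α, -α] := by
  rw [connX_transpose]
  ext i j
  fin_cases i <;> fin_cases j <;> simp [connX, matJ1] <;> ring

theorem matJ1_mul_connY_transpose_mul (β k c Q B : ℝ) :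
    matJ1 * (connY β k c Q B)ᵀ * matJ1 =
      connY β k c Q B - (2 : ℝ) • Matrix.diagonal ![β, β, -β, -β] := by
  rw [connY_transpose]
  ext i j
  fin_cases i <;> fin_cases j <;> simp [connY, matJ1] <;> ring

/-- This is `∇_x ∂_y g₁ = 0` in the frame. The middle matrix is the `x`-derivative of `gaussY` with
`k_x = -2αk` and `c_x = 2αc` inserted; the diagonal action has weights `2α` on `k`, `-2α` on `c` and
`0` on the constant entries. -/
theorem diagonal_mul_gaussY_add (α k c : ℝ) :
    Matrix.diagonal ![α, -α, α, -α] * gaussY k c 0 0 +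
      !![0, 0, 2 * -(2 * α * k), 0; 0, 2 * (2 * α * c), 0, 0;
        2 * -(2 * α * k), 0, 0, 0; 0, 0, 0, 0] +
      gaussY k c 0 0 * (Matrix.diagonal ![α, -α, α, -α])ᵀ = 0 := by
  ext i j
  rw [Matrix.diagonal_transpose, Matrix.add_apply, Matrix.add_apply, Matrix.diagonal_mul,
    Matrix.mul_diagonal]
  fin_cases i <;> fin_cases j <;> simp [gaussY] <;> ring

theorem diagonal_mul_gaussX_add (β l b : ℝ) :
    Matrix.diagonal ![β, β, -β, -β] * gaussX l b 0 0 +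
      !![0, 2 * -(2 * β * l), 0, 0; 2 * -(2 * β * l), 0, 0, 0;
        0, 0, 2 * (2 * β * b), 0; 0, 0, 0, 0] +
      gaussX l b 0 0 * (Matrix.diagonal ![β, β, -β, -β])ᵀ = 0 := by
  ext i j
  rw [Matrix.diagonal_transpose, Matrix.add_apply, Matrix.add_apply, Matrix.diagonal_mul,
    Matrix.mul_diagonal]
  fin_cases i <;> fin_cases j <;> simp [gaussX] <;> ring

/-- The first-order Gauss map is conformal if and only if `P = Q = 0`. -/
theorem IsCanonicalSurface.isLorentzConformal_iff (hD : IsOpen D)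
    (hS : IsCanonicalSurface D f b c p q) :
    IsLorentzConformal D (firstOrderGaussMap f b c) ↔
      ∀ z ∈ D, invP b c p z = 0 ∧ invQ b c q z = 0 := by
  obtain ⟨hF, α, β, k, l, -, -, -, -, -, -, hE⟩ := hS.exists_connection hD
  rw [_root_.isLorentzConformal_iff]
  refine forall₂_congr fun z hz => ?_
  obtain ⟨-, -, hx, hy, -, -⟩ := hE z hz
  have dF : ∀ i j, DifferentiableAt ℝ (fun w => wilczynskiFrame f b c w i j) z := fun i j =>
    (hF i j).differentiableAt_of_isOpen hD hz
  have hJ : ∀ i j, DifferentiableAt ℝ (fun _ : ℝ × ℝ => matJ1 i j) z :=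
    fun i j => differentiableAt_const _
  have h1 : matDeriv (firstOrderGaussMap f b c) z (1, 0) = _ :=
    matDeriv_mul_mul_transpose (S := fun _ => matJ1) dF hJ hx
  have h2 : matDeriv (firstOrderGaussMap f b c) z (0, 1) = _ :=
    matDeriv_mul_mul_transpose (S := fun _ => matJ1) dF hJ hy
  rw [matDeriv_const, add_zero, ← gaussX_eq] at h1
  rw [matDeriv_const, add_zero, ← gaussY_eq] at h2
  rw [h1, h2, firstOrderGaussMap,
    quadricMetric_mul_mul_transpose matJ1_mul_self (hS.det_frame z hz),
    quadricMetric_mul_mul_transpose matJ1_mul_self (hS.det_frame z hz), trace_gaussX,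
    trace_gaussY]
  simp

/-- If `P = Q = 0`, then the first-order Gauss map is Lorentz harmonic. -/
theorem IsCanonicalSurface.isLorentzHarmonic (hD : IsOpen D)
    (hS : IsCanonicalSurface D f b c p q)
    (h0 : ∀ z ∈ D, invP b c p z = 0 ∧ invQ b c q z = 0) :
    IsLorentzHarmonic D (firstOrderGaussMap f b c) := by
  obtain ⟨hF, α, β, k, l, -, -, hk, hl, -, -, hE⟩ := hS.exists_connection hD
  refine ⟨fun i j => ?_, fun z hz => mul_matJ1_mul_transpose_mem_quadricSpace
    (hS.det_frame z hz), fun z hz => ?_⟩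
  · simp only [firstOrderGaussMap, Matrix.mul_apply, Matrix.transpose_apply]
    exact ContDiffOn.sum fun x _ =>
      (ContDiffOn.sum fun y _ => (hF i y).mul contDiffOn_const).mul (hF j x)
  have dF : ∀ y ∈ D, ∀ i j, DifferentiableAt ℝ (fun w => wilczynskiFrame f b c w i j) y :=
    fun y hy i j => (hF i j).differentiableAt_of_isOpen hD hy
  have hJ : ∀ y : ℝ × ℝ, ∀ i j, DifferentiableAt ℝ (fun _ : ℝ × ℝ => matJ1 i j) y :=
    fun y i j => differentiableAt_const _
  have hx : ∀ y ∈ D, matDeriv (wilczynskiFrame f b c) y (1, 0) =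
      wilczynskiFrame f b c y * connX (α y) (l y) (b y) 0 0 := fun y hy => by
    rw [(hE y hy).2.2.1, (h0 y hy).1, (h0 y hy).2, mul_zero]
  have hy : ∀ y ∈ D, matDeriv (wilczynskiFrame f b c) y (0, 1) =
      wilczynskiFrame f b c y * connY (β y) (k y) (c y) 0 0 := fun y hy => by
    rw [(hE y hy).2.2.2.1, (h0 y hy).1, (h0 y hy).2, mul_zero]
  have h1 : ∀ y ∈ D, matDeriv (firstOrderGaussMap f b c) y (1, 0) =
      wilczynskiFrame f b c y * gaussX (l y) (b y) 0 0 * (wilczynskiFrame f b c y)ᵀ := by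
    intro y hy
    rw [gaussX_eq (α y)]
    refine (matDeriv_mul_mul_transpose (S := fun _ => matJ1) (dF y hy) (hJ y) (hx y hy)).trans ?_
    rw [matDeriv_const, add_zero]
  have h2 : ∀ y ∈ D, matDeriv (firstOrderGaussMap f b c) y (0, 1) =
      wilczynskiFrame f b c y * gaussY (k y) (c y) 0 0 * (wilczynskiFrame f b c y)ᵀ := by
    intro y hyD
    rw [gaussY_eq (β y)]
    refine (matDeriv_mul_mul_transpose (S := fun _ => matJ1) (dF y hyD) (hJ y)
      (hy y hyD)).trans ?_
    rw [matDeriv_const, add_zero]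
  obtain ⟨hcα, hbβ, -, -, hPy, hQx⟩ := hE z hz
  -- As `P` and `Q` vanish on the whole open set, so do their derivatives, and the compatibility
  -- equations become `k_x = -2αk` and `l_y = -2βl`.
  have hPy' : dY (invP b c p) z = 0 :=
    (dirDeriv_congr hD (0, 1) (fun y hy => (h0 y hy).1) hz).trans (by simp [dirDeriv])
  have hQx' : dX (invQ b c q) z = 0 :=
    (dirDeriv_congr hD (1, 0) (fun y hy => (h0 y hy).2) hz).trans (by simp [dirDeriv])
  rw [hPy'] at hPy
  rw [hQx'] at hQx
  have ek : fderiv ℝ k z (1, 0) = -(2 * α z * k z) := eq_neg_of_add_eq_zero_left hPy.symm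
  have el : fderiv ℝ l z (0, 1) = -(2 * β z * l z) := eq_neg_of_add_eq_zero_left hQx.symm
  have ec : fderiv ℝ c z (1, 0) = 2 * α z * c z := hcα
  have eb : fderiv ℝ b z (0, 1) = 2 * β z * b z := hbβ
  have dk := hk.differentiableAt_of_isOpen hD hz
  have dl := hl.differentiableAt_of_isOpen hD hz
  have db := hS.smooth_b.differentiableAt_of_isOpen hD hz
  have dc := hS.smooth_c.differentiableAt_of_isOpen hD hz
  have d0 : DifferentiableAt ℝ (fun _ : ℝ × ℝ => (0 : ℝ)) z := differentiableAt_const _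
  have hg : firstOrderGaussMap f b c =
      fun y => wilczynskiFrame f b c y * matJ1 * (wilczynskiFrame f b c y)ᵀ := rfl
  rw [lorentzTension, covDeriv_congr hD _ h1 hz, covDeriv_congr hD _ h2 hz, hg,
    covDeriv_mul_mul_transpose matJ1_mul_self transpose_matJ1 (dF z hz)
      (differentiableAt_gaussY dk dc d0 d0)
      (hS.det_frame z hz) (hx z hz) (matJ1_mul_connX_transpose_mul _ _ _ _ _),
    covDeriv_mul_mul_transpose matJ1_mul_self transpose_matJ1 (dF z hz)
      (differentiableAt_gaussX dl db d0 d0)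
      (hS.det_frame z hz) (hy z hz) (matJ1_mul_connY_transpose_mul _ _ _ _ _),
    matDeriv_gaussX_zero dl db, matDeriv_gaussY_zero dk dc, ek, el, ec, eb]
  rw [diagonal_mul_gaussY_add, diagonal_mul_gaussX_add]
  simp

end FirstOrderGaussMap

/-! ### Demoulin transforms in frame coordinates. -/

noncomputable section DemoulinTransforms

variable {D : Set (ℝ × ℝ)} {f : ℝ × ℝ → Fin 4 → ℝ} {b c p q : ℝ × ℝ → ℝ}

theorem map_ofReal_mul (A B : Matrix (Fin 4) (Fin 4) ℝ) :
    (A * B).map Complex.ofReal = A.map Complex.ofReal * B.map Complex.ofReal :=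
  Matrix.map_mul (f := Complex.ofRealHom)

theorem map_ofReal_one :
    (1 : Matrix (Fin 4) (Fin 4) ℝ).map Complex.ofReal = 1 :=
  Matrix.map_one _ Complex.ofReal_zero Complex.ofReal_one

theorem cQuad_transpose_mul_mul (N M : Matrix (Fin 4) (Fin 4) ℝ) (ζ : Fin 4 → ℂ) :
    cQuad (Nᵀ * M * N) ζ = cQuad M (N.map Complex.ofReal *ᵥ ζ) := by
  rw [cQuad, cQuad, map_ofReal_mul, map_ofReal_mul, Matrix.transpose_map, Matrix.mul_assoc,
    ← Matrix.mulVec_mulVec, ← Matrix.mulVec_mulVec, Matrix.dotProduct_mulVec,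
    Matrix.vecMul_transpose]

theorem cQuad_neg (M : Matrix (Fin 4) (Fin 4) ℝ) (ζ : Fin 4 → ℂ) :
    cQuad (-M) ζ = -cQuad M ζ := by
  have : (-M).map Complex.ofReal = -(M.map Complex.ofReal) := by ext; simp
  rw [cQuad, this, Matrix.neg_mulVec, dotProduct_neg, cQuad]

theorem cQuad_matJ2 (w : Fin 4 → ℂ) : cQuad matJ2 w = 2 * (w 0 * w 3 - w 1 * w 2) := by
  simp [cQuad, matJ2, dotProduct, Matrix.mulVec, Fin.sum_univ_four]
  ring

/-- Apart from the entries `A` and `b`, the matrix `U` is skew with respect to `J₂`, so only two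
squares survive. With `A = bQ` the form is a multiple of `w₁² - Q w₃²`. -/
theorem cQuad_connX (α l b P A : ℝ) (w : Fin 4 → ℂ) :
    cQuad (matJ2 * (connX α l b P A * matJ2 + matJ2 * (connX α l b P A)ᵀ) * matJ2) w =
      2 * (A * w 3 ^ 2 - b * w 1 ^ 2) := by
  rw [connX_transpose]
  simp [cQuad, matJ2, connX, dotProduct, Matrix.mulVec, Fin.sum_univ_four]
  ring

theorem cQuad_connY (β k c Q B : ℝ) (w : Fin 4 → ℂ) :
    cQuad (matJ2 * (connY β k c Q B * matJ2 + matJ2 * (connY β k c Q B)ᵀ) * matJ2) w =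
      2 * (B * w 3 ^ 2 - c * w 2 ^ 2) := by
  rw [connY_transpose]
  simp [cQuad, matJ2, connY, dotProduct, Matrix.mulVec, Fin.sum_univ_four]
  ring

/-- The coordinates of a complex vector with respect to a real frame. -/
def frameCoord (F : Matrix (Fin 4) (Fin 4) ℝ) (ζ : Fin 4 → ℂ) : Fin 4 → ℂ :=
  F⁻¹.map Complex.ofReal *ᵥ ζ

theorem frameCoord_mulVec {F : Matrix (Fin 4) (Fin 4) ℝ} (hF : F.det = 1) (w : Fin 4 → ℂ) :
    frameCoord F (F.map Complex.ofReal *ᵥ w) = w := by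
  rw [frameCoord, Matrix.mulVec_mulVec, ← map_ofReal_mul,
    Matrix.nonsing_inv_mul _ (by simp [hF]), map_ofReal_one, Matrix.one_mulVec]

theorem mulVec_frameCoord {F : Matrix (Fin 4) (Fin 4) ℝ} (hF : F.det = 1) (ζ : Fin 4 → ℂ) :
    F.map Complex.ofReal *ᵥ frameCoord F ζ = ζ := by
  rw [frameCoord, Matrix.mulVec_mulVec, ← map_ofReal_mul,
    Matrix.mul_nonsing_inv _ (by simp [hF]), map_ofReal_one, Matrix.one_mulVec]

theorem frameCoord_smul (F : Matrix (Fin 4) (Fin 4) ℝ) (a : ℂ) (ζ : Fin 4 → ℂ) :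
    frameCoord F (a • ζ) = a • frameCoord F ζ :=
  Matrix.mulVec_smul _ _ _

theorem frameCoord_surface {z : ℝ × ℝ} (hF : (wilczynskiFrame f b c z).det = 1) :
    frameCoord (wilczynskiFrame f b c z) (fun i => (f z i : ℂ)) = ![1, 0, 0, 0] := by
  have : (fun i => (f z i : ℂ)) =
      (wilczynskiFrame f b c z).map Complex.ofReal *ᵥ ![1, 0, 0, 0] := by
    ext i
    simp [Matrix.mulVec, dotProduct, Fin.sum_univ_four, wilczynskiFrame]
  rw [this, frameCoord_mulVec hF]

/-- The derivative of the inverse of `F J₂ Fᵗ` in a direction in which `F` has the derivative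
`F U`, as a quadratic form in the coordinates with respect to `F`. -/
theorem cQuad_matDeriv_inv {F : ℝ × ℝ → Matrix (Fin 4) (Fin 4) ℝ}
    {U : Matrix (Fin 4) (Fin 4) ℝ} {z v : ℝ × ℝ}
    (hF : ∀ i j, DifferentiableAt ℝ (fun y => F y i j) z) (hdet : (F z).det = 1)
    (hU : matDeriv F z v = F z * U) (ζ : Fin 4 → ℂ) :
    cQuad (matDeriv (fun w => (F w * matJ2 * (F w)ᵀ)⁻¹) z v) ζ =
      -cQuad (matJ2 * (U * matJ2 + matJ2 * Uᵀ) * matJ2) (frameCoord (F z) ζ) := by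
  have hJ : ∀ i j, DifferentiableAt ℝ (fun _ : ℝ × ℝ => matJ2 i j) z :=
    fun i j => differentiableAt_const _
  have hu : IsUnit (F z).det := by simp [hdet]
  have hu' : IsUnit (F z)ᵀ.det := by simp [hdet]
  have hFt : ∀ i j, DifferentiableAt ℝ (fun y => (F y)ᵀ i j) z := fun i j => hF j i
  have hJdet : matJ2.det ≠ 0 := by
    intro h
    simpa [h] using congrArg Matrix.det matJ2_mul_self
  have h1 := matDeriv_mul_mul_transpose (S := fun _ => matJ2) (v := v) hF hJ hU
  rw [matDeriv_const, add_zero] at h1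
  rw [matDeriv_inv v (differentiableAt_matMul (differentiableAt_matMul hF hJ) hFt)
    (by simp [hdet, hJdet]), h1, inv_mul_mul_transpose matJ2_mul_self]
  have h2 : (F z)⁻¹ᵀ * matJ2 * (F z)⁻¹ * (F z * (U * matJ2 + matJ2 * Uᵀ) * (F z)ᵀ) *
      ((F z)⁻¹ᵀ * matJ2 * (F z)⁻¹) =
      (F z)⁻¹ᵀ * (matJ2 * (U * matJ2 + matJ2 * Uᵀ) * matJ2) * (F z)⁻¹ := by
    simp only [Matrix.mul_assoc, Matrix.transpose_nonsing_inv,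
      Matrix.nonsing_inv_mul_cancel_left _ _ hu, Matrix.mul_nonsing_inv_cancel_left _ _ hu']
  rw [h2, cQuad_neg, cQuad_transpose_mul_mul]
  rfl

/-- The Demoulin transforms in coordinates with respect to the Wilczynski frame. -/
theorem IsCanonicalSurface.mem_demoulinTransforms_iff (hD : IsOpen D)
    (hS : IsCanonicalSurface D f b c p q) {z : ℝ × ℝ} (hz : z ∈ D)
    {R : ℙ ℂ (Fin 4 → ℂ)} {w : Fin 4 → ℂ}
    (hw : frameCoord (wilczynskiFrame f b c z) R.rep = w) :
    R ∈ demoulinTransforms f b c z ↔ w 0 * w 3 = w 1 * w 2 ∧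
      w 1 ^ 2 = invQ b c q z * w 3 ^ 2 ∧ w 2 ^ 2 = invP b c p z * w 3 ^ 2 ∧ w 3 ≠ 0 := by
  obtain ⟨hF, α, β, k, l, -, -, -, -, -, -, hE⟩ := hS.exists_connection hD
  obtain ⟨-, -, hx, hy, -, -⟩ := hE z hz
  have hdet := hS.det_frame z hz
  have dF : ∀ i j, DifferentiableAt ℝ (fun w => wilczynskiFrame f b c w i j) z := fun i j =>
    (hF i j).differentiableAt_of_isOpen hD hz
  have hb0 : (b z : ℂ) ≠ 0 := Complex.ofReal_ne_zero.2 (left_ne_zero_of_mul (hS.bc_ne z hz))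
  have hc0 : (c z : ℂ) ≠ 0 := Complex.ofReal_ne_zero.2 (right_ne_zero_of_mul (hS.bc_ne z hz))
  have e0 : cQuad (lieQuadric f b c z)⁻¹ R.rep = 2 * (w 0 * w 3 - w 1 * w 2) := by
    rw [lieQuadric, inv_mul_mul_transpose matJ2_mul_self, cQuad_transpose_mul_mul, ← hw,
      ← cQuad_matJ2]
    rfl
  have e1 : cQuad (matDeriv (fun w => (lieQuadric f b c w)⁻¹) z (1, 0)) R.rep =
      2 * b z * (w 1 ^ 2 - invQ b c q z * w 3 ^ 2) := by
    refine (cQuad_matDeriv_inv dF hdet hx R.rep).trans ?_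
    rw [cQuad_connX, hw]
    push_cast
    ring
  have e2 : cQuad (matDeriv (fun w => (lieQuadric f b c w)⁻¹) z (0, 1)) R.rep =
      2 * c z * (w 2 ^ 2 - invP b c p z * w 3 ^ 2) := by
    refine (cQuad_matDeriv_inv dF hdet hy R.rep).trans ?_
    rw [cQuad_connY, hw]
    push_cast
    ring
  -- On the solution set, `w₃ = 0` forces `w₁ = w₂ = 0`, which leaves only the first frame vector
  -- `f`. Excluding `[f]` thus means `w₃ ≠ 0`.
  have e3 : w 0 * w 3 = w 1 * w 2 → w 1 ^ 2 = invQ b c q z * w 3 ^ 2 →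
      w 2 ^ 2 = invP b c p z * w 3 ^ 2 →
      ((fun i => (f z i : ℂ)) ∈ R.submodule ↔ w 3 = 0) := by
    intro _ h1 h2
    rw [Projectivization.submodule_eq, Submodule.mem_span_singleton]
    have hf := frameCoord_surface hdet
    constructor
    · rintro ⟨a, ha⟩
      rw [← ha, frameCoord_smul, hw] at hf
      have h3 := congrFun hf 3
      have h4 := congrFun hf 0
      simp only [Pi.smul_apply, smul_eq_mul] at h3 h4
      rcases mul_eq_zero.1 h3 with h | h
      · simp [h] at h4
      · exact h
    · intro h3
      have h1' : w 1 = 0 := by simpa [h3] using h1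
      have h2' : w 2 = 0 := by simpa [h3] using h2
      have h0 : w 0 ≠ 0 := by
        intro h0
        apply R.rep_nonzero
        rw [← mulVec_frameCoord hdet R.rep, hw,
          show w = 0 by ext i; fin_cases i <;> assumption, Matrix.mulVec_zero]
      refine ⟨(w 0)⁻¹, ?_⟩
      rw [← mulVec_frameCoord hdet R.rep, hw, ← Matrix.mulVec_smul,
        ← mulVec_frameCoord hdet fun i => (f z i : ℂ), hf]
      congr 1
      ext i
      fin_cases i <;> simp [h0, h1', h2', h3]
  rw [demoulinTransforms, Set.mem_ofPred_eq, e0, e1, e2]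
  simp only [mul_eq_zero, two_ne_zero, hb0, hc0, false_or, sub_eq_zero]
  constructor
  · rintro ⟨h0, h1, h2, h3⟩
    exact ⟨h0, h1, h2, fun h => h3 ((e3 h0 h1 h2).2 h)⟩
  · rintro ⟨h0, h1, h2, h3⟩
    exact ⟨h0, h1, h2, fun h => h3 ((e3 h0 h1 h2).1 h)⟩

/-- Square roots of `Q` and `P` give a Demoulin transform. -/
theorem IsCanonicalSurface.exists_mem_demoulinTransforms (hD : IsOpen D)
    (hS : IsCanonicalSurface D f b c p q) {z : ℝ × ℝ} (hz : z ∈ D) {s t : ℂ}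
    (hs : s ^ 2 = invQ b c q z) (ht : t ^ 2 = invP b c p z) :
    ∃ R ∈ demoulinTransforms f b c z, ∃ a : ℂ, a ≠ 0 ∧
      frameCoord (wilczynskiFrame f b c z) R.rep = a • ![s * t, s, t, 1] := by
  have hdet := hS.det_frame z hz
  set ζ := (wilczynskiFrame f b c z).map Complex.ofReal *ᵥ ![s * t, s, t, 1] with hζ
  have hc : frameCoord (wilczynskiFrame f b c z) ζ = ![s * t, s, t, 1] := frameCoord_mulVec hdet _
  have h0 : ζ ≠ 0 := by
    intro h
    have h3 := congrFun hc 3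
    simp [h, frameCoord] at h3
  obtain ⟨a, ha⟩ := Projectivization.exists_smul_eq_mk_rep ℂ ζ h0
  have hw : frameCoord (wilczynskiFrame f b c z) (Projectivization.mk ℂ ζ h0).rep =
      (a : ℂ) • ![s * t, s, t, 1] := by
    rw [← ha, Units.smul_def, frameCoord_smul, hc]
  refine ⟨_, (hS.mem_demoulinTransforms_iff hD hz hw).2 ⟨?_, ?_, ?_, ?_⟩, a, a.ne_zero, hw⟩
  · simp
    ring
  · simp [← hs]
    ring
  · simp [← ht]
    ring
  · simp

/-- A surface is a Demoulin surface if and only if `P = Q = 0`. -/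
theorem IsCanonicalSurface.isDemoulinSurface_iff (hD : IsOpen D)
    (hS : IsCanonicalSurface D f b c p q) :
    IsDemoulinSurface D f b c ↔ ∀ z ∈ D, invP b c p z = 0 ∧ invQ b c q z = 0 := by
  refine forall₂_congr fun z hz => ?_
  constructor
  · intro h
    obtain ⟨s, hs⟩ := IsAlgClosed.exists_pow_nat_eq (invQ b c q z : ℂ) two_pos
    obtain ⟨t, ht⟩ := IsAlgClosed.exists_pow_nat_eq (invP b c p z : ℂ) two_pos
    obtain ⟨R, hR, a, ha, hw⟩ := hS.exists_mem_demoulinTransforms hD hz hs ht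
    -- Changing the signs of both roots gives a second transform; if it is the same point, comparing
    -- coordinates normalized by the last one yields `s = -s` and `t = -t`.
    obtain ⟨R', hR', a', -, hw'⟩ := hS.exists_mem_demoulinTransforms hD hz
      (s := -s) (t := -t) (by rwa [neg_sq]) (by rwa [neg_sq])
    rw [h.unique hR' hR, hw] at hw'
    have h3 := congrFun hw' 3
    have h1 := congrFun hw' 1
    have h2 := congrFun hw' 2
    simp at h1 h2 h3
    rw [← h3, ← mul_neg] at h1 h2
    have hs0 : s = 0 := self_eq_neg.1 (mul_left_cancel₀ ha h1)
    have ht0 : t = 0 := self_eq_neg.1 (mul_left_cancel₀ ha h2)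
    rw [hs0] at hs
    rw [ht0] at ht
    constructor
    · simpa using ht.symm
    · simpa using hs.symm
  · rintro ⟨hP, hQ⟩
    obtain ⟨R, hR, -⟩ := hS.exists_mem_demoulinTransforms (s := 0) (t := 0) hD hz
      (by simp [hQ]) (by simp [hP])
    -- When `P = Q = 0`, the equations leave only the last frame vector, so `[η]` is the single
    -- transform.
    have key : ∀ S ∈ demoulinTransforms f b c z, ∃ a : ℂ, a ≠ 0 ∧
        S.rep = a • (wilczynskiFrame f b c z).map Complex.ofReal *ᵥ ![0, 0, 0, 1] := by
      intro S hS'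
      obtain ⟨h0, h1, h2, h3⟩ := (hS.mem_demoulinTransforms_iff hD hz rfl).1 hS'
      refine ⟨_, h3, ?_⟩
      rw [← Matrix.mulVec_smul]
      conv_lhs => rw [← mulVec_frameCoord (hS.det_frame z hz) S.rep]
      have h1' : frameCoord (wilczynskiFrame f b c z) S.rep 1 = 0 := by simpa [hQ] using h1
      have h2' : frameCoord (wilczynskiFrame f b c z) S.rep 2 = 0 := by simpa [hP] using h2
      have h0' : frameCoord (wilczynskiFrame f b c z) S.rep 0 = 0 := by
        simpa [h1', h3] using h0
      congr 1
      ext i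
      fin_cases i <;> simp [h0', h1', h2']
    refine ⟨R, hR, fun S hS' => ?_⟩
    obtain ⟨a, ha, hRa⟩ := key R hR
    obtain ⟨a', -, hSa⟩ := key S hS'
    rw [← R.mk_rep, ← S.mk_rep, Projectivization.mk_eq_mk_iff']
    refine ⟨a' * a⁻¹, ?_⟩
    rw [hRa, hSa, smul_smul, inv_mul_cancel_right₀ ha]

end DemoulinTransforms

theorem mainTheorem3 (D : Set (ℝ × ℝ)) (hD : IsOpen D) (f : ℝ × ℝ → Fin 4 → ℝ)
    (b c p q : ℝ × ℝ → ℝ) (hS : IsCanonicalSurface D f b c p q) :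
    (IsDemoulinSurface D f b c ↔
      IsLorentzConformal D (firstOrderGaussMap f b c) ∧
        IsLorentzHarmonic D (firstOrderGaussMap f b c)) ∧
    (IsDemoulinSurface D f b c ↔ ∀ z ∈ D, invP b c p z = 0 ∧ invQ b c q z = 0) := by
  refine ⟨?_, hS.isDemoulinSurface_iff hD⟩
  rw [hS.isDemoulinSurface_iff hD, hS.isLorentzConformal_iff hD]
  -- Harmonicity comes for free from `P = Q = 0`; the converse uses conformality only.
  exact ⟨fun h => ⟨h, hS.isLorentzHarmonic hD h⟩, fun h => h.1⟩
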